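/- Let $G_\Delta$ be the infinite triangular grid, in which every node has six neighbours. Let $\mathcal P$ be a finite, nonempty set of nodes that is simply connected, i.e. both $\mathcal P$ and its complement induce connected subgraphs of $G_\Delta$; each node of $\mathcal P$ holds one particle, and the other nodes are empty. Each particle labels its six ports by $\mathbb Z/6$ so that ports $i$ and $i+1$ lead to adjacent nodes; the particles need not agree on a direction or on a chirality. The register of a particle $p$ holds a value $\mathrm{link}_p[v]\in\{\mathit{in},\mathit{out}\}$ for each neighbouring node $v$, and $\mathrm{link}_p[v]=\mathit{in}$ if $v$ is empty. A configuration consists of $\mathcal P$ and the contents of all registers. For adjacent particles $p,q$, the edge $pq$ is directed from $p$ to $q$ (outgoing for $p$) if $\mathrm{link}_p[q]=\mathit{out}$ and $\mathrm{link}_q[p]=\mathit{in}$, and it is undirected if $\mathrm{link}_p[q]=\mathrm{link}_q[p]=\mathit{in}$. Consider the following rules at a particle $p$. - R1: every edge between $p$ and another particle is directed one way or the other. - R2: $p$ has at most three outgoing edges. - R3: in the cyclic order of the ports of $p$, the outgoing edges of $p$ are consecutive. - R4: no triangle of particles containing $p$ is a directed cycle. When $p$ executes the algorithm, it reads its own register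 and those of the neighbouring particles and rewrites its own register as follows. First it sets $\mathrm{link}_p[q]=\mathit{in}$ for every $q$ with $\mathrm{link}_p[q]=\mathrm{link}_q[p]=\mathit{out}$. Then, if R1 fails at $p$, it marks all its undirected edges as outgoing. Then, if R2, R3 or R4 fails at $p$, it marks all its outgoing edges as undirected. A particle is activable in a configuration if executing the algorithm changes its register. A successor of a configuration $C$ is obtained when a nonempty set of particles activable in $C$ execute concurrently, each reading the registers as they are in $C$; it is a sequential successor if this set has one element. A (sequential) execution is an infinite sequence $C_0,C_1,\dots$ of configurations such that, for every $i$, either $C_{i+1}$ is a (sequential) successor of $C_i$, or no particle is activable in $C_i$ and $C_{i+1}=C_i$. It is (sequential) Gouda fair if, for every configuration $C$ that appears infinitely often in it, every (sequential) successor of $C$ appears infinitely often in it. Theorem. Let $C_0,C_1,\dots$ be a Gouda fair execution, or a sequential Gouda fair execution, whose initial configuration $C_0$ has a simply connected support and arbitrary register contents. Then there is an $n$ such that in $C_n$ no particle is activable, every particle satisfies R1–R4, and exactly one particle (the leader) is a sink, i.e. has no outgoing edge. -/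

import Mathlib

namespace ParticleSystem

/-- Nodes of the triangular grid, in the coordinates of a basis of two grid vectors at angle 60°. -/
abbrev Node : Type := ℤ × ℤ

/-- The infinite regular triangular grid: every node has six neighbours. -/
def triGrid : SimpleGraph Node where
  Adj u v := v - u ∈ ({(1, 0), (0, 1), (-1, 1), (-1, 0), (0, -1), (1, -1)} : Set Node)
  symm := ⟨by
    rintro ⟨a, b⟩ ⟨c, d⟩ h
    simp only [Prod.mk_sub_mk, Set.mem_insert_iff, Set.mem_singleton_iff, Prod.mk.injEq] at h ⊢
    omega⟩
  loopless := ⟨by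
    rintro ⟨a, b⟩ h
    simp only [Prod.mk_sub_mk, Set.mem_insert_iff, Set.mem_singleton_iff, Prod.mk.injEq] at h
    omega⟩

/-- A finite set of nodes that is (nonempty and) connected and has a connected complement. -/
structure SimplyConnected (P : Finset Node) : Prop where
  connected : (triGrid.induce (P : Set Node)).Connected
  compl_connected : (triGrid.induce ((P : Set Node)ᶜ)).Connected

/-- Each particle numbers its six ports by `0, …, 5` in such a way that ports `i` and `i + 1 mod 6`
lead to neighbouring nodes. The particles need not agree on a direction, nor on a chirality. -/
structure PortLabelling where
  port : (p : Node) → ZMod 6 ≃ triGrid.neighborSet p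
  consecutive : ∀ p i, triGrid.Adj (port p i : Node) (port p (i + 1) : Node)

/-- The two values of a variable `link_p[v]`. -/
inductive Link
  | inn
  | out

/-- A configuration: the support and the registers. The register of the particle `p` consists of
the variables `link p v` for the neighbouring nodes `v`, which are `inn` if `v` is empty.
(For pairs that are not adjacent particles, `link` carries no information and is `inn`.) -/
@[ext]
structure Config where
  support : Finset Node
  link : Node → Node → Link
  mem_of_out : ∀ p v, link p v = Link.out → p ∈ support ∧ v ∈ support ∧ triGrid.Adj p v

namespace Config

/-- The edge `pq` is directed from `p` to `q`: it is outgoing for `p` and incoming for `q`. -/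
def Outgoing (C : Config) (p q : Node) : Prop :=
  C.link p q = Link.out ∧ C.link q p = Link.inn

/-- `pq` is an edge between two particles and it is undirected. -/
def Undirected (C : Config) (p q : Node) : Prop :=
  p ∈ C.support ∧ q ∈ C.support ∧ triGrid.Adj p q ∧ C.link p q = Link.inn ∧ C.link q p = Link.inn

/-- Both endpoints claim the edge `pq` as outgoing. -/
def Conflicting (C : Config) (p q : Node) : Prop :=
  C.link p q = Link.out ∧ C.link q p = Link.out

/-- R1 at `p`: each edge between `p` and another particle is oriented,
and both endpoints agree on the direction. -/
def R1 (C : Config) (p : Node) : Prop :=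
  ∀ q ∈ C.support, triGrid.Adj p q → C.Outgoing p q ∨ C.Outgoing q p

/-- R2 at `p`: at most three outgoing edges. -/
def R2 (C : Config) (p : Node) : Prop :=
  {q | C.Outgoing p q}.ncard ≤ 3

/-- R3 at `p`: in the cyclic order of the ports, the outgoing edges of `p` are consecutive,
that is, they are at the ports `i, i + 1, …, i + k - 1` for some `i` and `k`. -/
def R3 (L : PortLabelling) (C : Config) (p : Node) : Prop :=
  ∃ (i : ZMod 6) (k : ℕ), ∀ j : ZMod 6,
    C.Outgoing p (L.port p j) ↔ ∃ m : ℕ, m < k ∧ j = i + (m : ZMod 6)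

/-- R4 at `p`: no triangle containing `p` is a directed cycle. -/
def R4 (C : Config) (p : Node) : Prop :=
  ∀ q r, ¬ (C.Outgoing p q ∧ C.Outgoing q r ∧ C.Outgoing r p)

/-- Every particle satisfies R1–R4. -/
def Valid (L : PortLabelling) (C : Config) : Prop :=
  ∀ p ∈ C.support, C.R1 p ∧ C.R2 p ∧ C.R3 L p ∧ C.R4 p

/-- A particle without outgoing edges. -/
def IsSink (C : Config) (p : Node) : Prop :=
  p ∈ C.support ∧ ∀ q, ¬ C.Outgoing p q

open Classical in
/-- The particle `p` writes `r` into its register; the links to empty nodes are always `inn`. -/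
noncomputable def write (C : Config) (p : Node) (r : Node → Link) : Config where
  support := C.support
  link u v :=
    if u = p then
      if u ∈ C.support ∧ v ∈ C.support ∧ triGrid.Adj u v then r v else Link.inn
    else C.link u v
  mem_of_out := by
    intro u v h
    split_ifs at h with h₁ h₂
    · exact h₂
    · exact C.mem_of_out u v h

open Classical in
/-- The special case of the encoding: the activated particle `p` gives up the edges which both
endpoints claim as outgoing, by marking them as `inn`. -/
noncomputable def resolve (C : Config) (p : Node) : Config :=
  C.write p fun q => if C.Conflicting p q then Link.inn else C.link p q

open Classical in
/-- First line: if R1 fails at `p`, mark all undirected edges of `p` as outgoing. -/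
noncomputable def line1 (C : Config) (p : Node) : Config :=
  if ¬ C.R1 p then C.write p fun q => if C.Undirected p q then Link.out else C.link p q else C

open Classical in
/-- Second line: if R2, R3 or R4 fails at `p`, mark all outgoing edges of `p` as undirected. -/
noncomputable def line2 (L : PortLabelling) (C : Config) (p : Node) : Config :=
  if ¬ C.R2 p ∨ ¬ C.R3 L p ∨ ¬ C.R4 p then
    C.write p fun q => if C.Outgoing p q then Link.inn else C.link p q
  else C

/-- The result of the execution of the algorithm by `p` alone: always both lines, in this order. -/
noncomputable def exec (L : PortLabelling) (C : Config) (p : Node) : Config :=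
  ((C.resolve p).line1 p).line2 L p

theorem exec_support (L : PortLabelling) (C : Config) (p : Node) :
    (C.exec L p).support = C.support := by
  have h₁ : ∀ D : Config, (D.line1 p).support = D.support := by
    intro D
    unfold line1
    split_ifs <;> rfl
  have h₂ : ∀ D : Config, (D.line2 L p).support = D.support := by
    intro D
    unfold line2
    split_ifs <;> rfl
  unfold exec
  rw [h₂, h₁]
  rfl

/-- `p` is activable: executing the algorithm modifies the register of `p`. -/
def Activable (L : PortLabelling) (C : Config) (p : Node) : Prop :=
  p ∈ C.support ∧ (C.exec L p).link p ≠ C.link p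

open Classical in
/-- All particles of `Q` execute the algorithm concurrently: each of them reads the registers as
they are in `C` and rewrites its own register. -/
noncomputable def fire (L : PortLabelling) (C : Config) (Q : Finset Node) : Config where
  support := C.support
  link u v := if u ∈ Q then (C.exec L u).link u v else C.link u v
  mem_of_out := by
    intro u v h
    split_ifs at h
    · simpa only [exec_support] using (C.exec L u).mem_of_out u v h
    · exact C.mem_of_out u v h

/-- No particle is activable. -/
def Final (L : PortLabelling) (C : Config) : Prop :=
  ∀ p, ¬ C.Activable L p

/-- `C'` is obtained from `C` when a nonempty set of activable particles executes. -/
def Successor (L : PortLabelling) (C C' : Config) : Prop :=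
  ∃ Q : Finset Node, Q.Nonempty ∧ (∀ p ∈ Q, C.Activable L p) ∧ C' = C.fire L Q

/-- `C'` is obtained from `C` when one activable particle executes. -/
def SeqSuccessor (L : PortLabelling) (C C' : Config) : Prop :=
  ∃ p, C.Activable L p ∧ C' = C.fire L {p}

end Config

/-- An execution: infinite, and it repeats a configuration only if no particle is activable. -/
def IsExecution (L : PortLabelling) (S : ℕ → Config) : Prop :=
  ∀ i, (S i).Successor L (S (i + 1)) ∨ ((S i).Final L ∧ S (i + 1) = S i)

/-- A sequential execution: exactly one particle executes in each step from a configuration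
that is not final. -/
def IsSeqExecution (L : PortLabelling) (S : ℕ → Config) : Prop :=
  ∀ i, (S i).SeqSuccessor L (S (i + 1)) ∨ ((S i).Final L ∧ S (i + 1) = S i)

/-- The configuration `C` appears infinitely often in `S`. -/
def InfinitelyOften (S : ℕ → Config) (C : Config) : Prop :=
  ∀ n, ∃ i, n ≤ i ∧ S i = C

/-- A Gouda fair execution. -/
def IsGoudaFairExecution (L : PortLabelling) (S : ℕ → Config) : Prop :=
  IsExecution L S ∧
    ∀ C C', InfinitelyOften S C → C.Successor L C' → InfinitelyOften S C'

/-- A sequential Gouda fair execution. -/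
def IsSeqGoudaFairExecution (L : PortLabelling) (S : ℕ → Config) : Prop :=
  IsSeqExecution L S ∧
    ∀ C C', InfinitelyOften S C → C.SeqSuccessor L C' → InfinitelyOften S C'

end ParticleSystem

/-! Say that a particle claims an edge if it marks it as outgoing, and call a set `X` of particles
closed if it contains all endpoints of undirected edges and no claimed edge leaves it. Only
particles of a closed set can still become active.

*Termination.* It suffices to reach some configuration without undirected edges, because a Gouda
fair execution visits every configuration reachable from one that recurs. Execute every particle
once, so that undirected edges are the only violations left, and take a closed set `X` that is
minimal among those of all reachable configurations. The particles outside `X` have no undirected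
edges, so a hole of `X` would be a finite region whose boundary edges are all outgoing, which R2
and R3 exclude. By a discrete Gauss-Bonnet formula, a finite nonempty set without holes has a node
`u` whose neighbours in the set form an arc of at most three nodes, with centre `b` unless `u` is
isolated. As `X` is minimal, every particle of `X` can be made a sink. Once `b` is one, `u` can
claim all its remaining edges, and from then on `u` can keep its edge to `b`. It only ever gains
further outgoing edges, and when it cannot gain any more, its in-neighbours in `X` can never become
sinks, so that it has none. But then `X` without `u` is closed, hence `X` is empty.

*Leader.* If all edges are directed, charge every edge and every triangle to its source: each
particle contributes one minus the Euler characteristic of its out-neighbourhood to the Euler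
characteristic of the support, which is `1`. This is `0` if the out-neighbours form a nonempty
arc and `1` if the particle is a sink. -/

namespace ParticleSystem

open Finset

/-! ### Euler characteristics of finite sets of vertices -/

section EulerCharacteristic

variable {V : Type*} (G : SimpleGraph V) [DecidableRel G.Adj]

/-- The number of vertices minus the number of edges of the subgraph of `G` induced on `X`. Each
edge is counted as two ordered pairs. -/
def graphEulerChar (X : Finset V) : ℚ :=
  #X - (∑ p ∈ X, ∑ q ∈ X, if G.Adj p q then 1 else 0) / 2

/-- The Euler characteristic of the two-dimensional clique complex of the subgraph of `G` induced
on `X`: vertices minus edges plus triangles. Each triangle is counted as six ordered triples. -/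
def eulerChar (X : Finset V) : ℚ :=
  graphEulerChar G X +
    (∑ p ∈ X, ∑ q ∈ X, ∑ r ∈ X, if G.Adj p q ∧ G.Adj p r ∧ G.Adj q r then 1 else 0) / 6

variable {G}

theorem sum_filter_adj (X : Finset V) (p : V) :
    ∑ q ∈ X, (if G.Adj p q then (1 : ℚ) else 0) = #(X.filter (G.Adj p)) := by
  simp only [sum_boole]

theorem sum_triangles (X : Finset V) (p : V) :
    ∑ q ∈ X, ∑ r ∈ X, (if G.Adj p q ∧ G.Adj p r ∧ G.Adj q r then (1 : ℚ) else 0) =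
      2 * (#(X.filter (G.Adj p)) - graphEulerChar G (X.filter (G.Adj p))) := by
  rw [graphEulerChar, sub_sub_cancel, mul_div_cancel₀ _ two_ne_zero]
  simp only [sum_filter, ite_and, sum_ite_irrel, sum_const_zero]

theorem eulerChar_eq_sum_curvature (X : Finset V) :
    eulerChar G X =
      ∑ p ∈ X, (1 - #(X.filter (G.Adj p)) / 6 - graphEulerChar G (X.filter (G.Adj p)) / 3) := by
  simp only [eulerChar, graphEulerChar.eq_1 G X, sum_triangles, sum_filter_adj, sum_sub_distrib,
    ← mul_sum, ← sum_div, sum_const, nsmul_eq_mul, mul_one]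
  ring

theorem eulerChar_singleton (q : V) : eulerChar G {q} = 1 := by
  simp [eulerChar, graphEulerChar]

theorem graphEulerChar_insert [DecidableEq V] {X : Finset V} {q : V} (hq : q ∉ X) :
    graphEulerChar G (insert q X) = graphEulerChar G X + 1 - #(X.filter (G.Adj q)) := by
  simp only [graphEulerChar, card_insert_of_notMem hq, sum_insert hq, sum_add_distrib,
    G.adj_comm _ q, sum_filter_adj, G.irrefl, if_false]
  push_cast
  ring

theorem eulerChar_insert [DecidableEq V] {X : Finset V} {q : V} (hq : q ∉ X) :
    eulerChar G (insert q X) = eulerChar G X + 1 - graphEulerChar G (X.filter (G.Adj q)) := by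
  have hsecond : ∑ p ∈ X, ∑ r ∈ X, (if G.Adj p q ∧ G.Adj p r ∧ G.Adj q r then (1 : ℚ) else 0) =
      ∑ p ∈ X, ∑ r ∈ X, if G.Adj q p ∧ G.Adj q r ∧ G.Adj p r then 1 else 0 :=
    sum_congr rfl fun p _ => sum_congr rfl fun r _ => if_congr (by grind [G.adj_comm]) rfl rfl
  have hthird : ∑ p ∈ X, ∑ r ∈ X, (if G.Adj p r ∧ G.Adj p q ∧ G.Adj r q then (1 : ℚ) else 0) =
      ∑ p ∈ X, ∑ r ∈ X, if G.Adj q p ∧ G.Adj q r ∧ G.Adj p r then 1 else 0 :=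
    sum_congr rfl fun p _ => sum_congr rfl fun r _ => if_congr (by grind [G.adj_comm]) rfl rfl
  simp only [eulerChar, graphEulerChar_insert hq, sum_insert hq, sum_add_distrib, hsecond, hthird,
    sum_triangles X q, G.irrefl, false_and, and_false, if_false, sum_const_zero]
  ring

section Orientation

variable {X : Finset V} {O : V → V → Prop} [DecidableRel O]
  (hadj : ∀ p q, O p q → G.Adj p q) (hasymm : ∀ p q, O p q → ¬ O q p)
  (htotal : ∀ p ∈ X, ∀ q ∈ X, G.Adj p q → O p q ∨ O q p)

include hadj hasymm htotal

theorem sum_edges_eq_of_orientation :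
    ∑ p ∈ X, ∑ q ∈ X, (if G.Adj p q then (1 : ℚ) else 0) =
      2 * ∑ p ∈ X, ∑ q ∈ X, if O p q then 1 else 0 := by
  have hsplit : ∑ p ∈ X, ∑ q ∈ X, (if G.Adj p q then (1 : ℚ) else 0) =
      ∑ p ∈ X, ∑ q ∈ X, ((if O p q then 1 else 0) + if O q p then 1 else 0) := by
    refine sum_congr rfl fun p hp => sum_congr rfl fun q hq => ?_
    have h₁ := hadj p q
    have h₂ := hadj q p
    have h₃ := hasymm p q
    have h₄ := htotal p hp q hq
    rw [G.adj_comm q p] at h₂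
    split_ifs <;> simp_all
  rw [hsplit]
  simp only [sum_add_distrib]
  rw [two_mul, sum_comm (f := fun p q => if O q p then (1 : ℚ) else 0)]

theorem sum_triangles_eq_of_orientation (hacyclic : ∀ p q r, ¬ (O p q ∧ O q r ∧ O r p)) :
    ∑ p ∈ X, ∑ q ∈ X, ∑ r ∈ X,
        (if G.Adj p q ∧ G.Adj p r ∧ G.Adj q r then (1 : ℚ) else 0) =
      3 * ∑ p ∈ X, ∑ q ∈ X, ∑ r ∈ X, if O p q ∧ O p r ∧ G.Adj q r then 1 else 0 := by
  have hsplit : ∑ p ∈ X, ∑ q ∈ X, ∑ r ∈ X,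
      (if G.Adj p q ∧ G.Adj p r ∧ G.Adj q r then (1 : ℚ) else 0) =
      ∑ p ∈ X, ∑ q ∈ X, ∑ r ∈ X, ((if O p q ∧ O p r ∧ G.Adj q r then 1 else 0) +
        (if O q p ∧ O q r ∧ G.Adj p r then 1 else 0) +
        (if O r p ∧ O r q ∧ G.Adj p q then 1 else 0)) := by
    -- A triangle that is not a directed cycle has exactly one source.
    refine sum_congr rfl fun p hp => sum_congr rfl fun q hq => sum_congr rfl fun r hr => ?_
    have := hacyclic p q r
    have := hacyclic p r q
    grind [SimpleGraph.Adj.symm]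
  rw [hsplit]
  simp only [sum_add_distrib]
  have hq : ∑ p ∈ X, ∑ q ∈ X, ∑ r ∈ X, (if O q p ∧ O q r ∧ G.Adj p r then (1 : ℚ) else 0) =
      ∑ p ∈ X, ∑ q ∈ X, ∑ r ∈ X, if O p q ∧ O p r ∧ G.Adj q r then 1 else 0 := sum_comm
  have hr : ∑ p ∈ X, ∑ q ∈ X, ∑ r ∈ X, (if O r p ∧ O r q ∧ G.Adj p q then (1 : ℚ) else 0) =
      ∑ p ∈ X, ∑ q ∈ X, ∑ r ∈ X, if O p q ∧ O p r ∧ G.Adj q r then 1 else 0 :=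
    (sum_congr rfl fun _ _ => sum_comm).trans sum_comm
  rw [hq, hr]
  ring

theorem eulerChar_eq_sum_of_orientation (hacyclic : ∀ p q r, ¬ (O p q ∧ O q r ∧ O r p)) :
    eulerChar G X = ∑ p ∈ X, (1 - graphEulerChar G (X.filter (O p))) := by
  have hout (p : V) :
      ∑ q ∈ X, ∑ r ∈ X, (if O p q ∧ O p r ∧ G.Adj q r then (1 : ℚ) else 0) =
        2 * (#(X.filter (O p)) - graphEulerChar G (X.filter (O p))) := by
    rw [graphEulerChar, sub_sub_cancel, mul_div_cancel₀ _ two_ne_zero]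
    simp only [sum_filter, ite_and, sum_ite_irrel, sum_const_zero]
  have sum_filter_out (p : V) : ∑ q ∈ X, (if O p q then (1 : ℚ) else 0) = #(X.filter (O p)) := by
    simp only [sum_boole]
  rw [eulerChar, graphEulerChar, sum_edges_eq_of_orientation hadj hasymm htotal,
    sum_triangles_eq_of_orientation hadj hasymm htotal hacyclic]
  simp only [hout, sum_filter_out, sum_sub_distrib, ← mul_sum, sum_const, nsmul_eq_mul, mul_one]
  ring

end Orientation

end EulerCharacteristic

/-! ### Components and holes of finite sets of vertices -/

section Components

variable {V : Type*} (G : SimpleGraph V)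

/-- `A` is a union of connected components of the subgraph of `G` induced on `X`. -/
def IsUnionOfComponents (X A : Finset V) : Prop :=
  A ⊆ X ∧ ∀ a ∈ A, ∀ b ∈ X, G.Adj a b → b ∈ A

/-- The set `S` meets every connected component of the subgraph of `G` induced on `X`. It is allowed
to have elements outside `X`. -/
def MeetsComponents (X S : Finset V) : Prop :=
  ∀ A, IsUnionOfComponents G X A → A.Nonempty → ∃ s ∈ S, s ∈ A

/-- The subgraph of `G` induced on `X` has at most one connected component. -/
def NoCut (X : Finset V) : Prop :=
  ∀ A, IsUnionOfComponents G X A → A.Nonempty → A = X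

/-- The complement of `X` has no finite connected component: from every larger finite set one can
leave through a node outside `X`. -/
def NoHole (X : Finset V) : Prop :=
  ∀ Y, X ⊂ Y → ∃ q ∈ Y, q ∉ X ∧ ∃ z ∉ Y, G.Adj q z

/-- The Euler characteristic of `X` is at least the number of its connected components. -/
def EulerBound [DecidableRel G.Adj] (X : Finset V) : Prop :=
  ∃ S, MeetsComponents G X S ∧ #S ≤ eulerChar G X

variable {G} {X A S : Finset V} {q : V}

theorem eulerBound_singleton [DecidableRel G.Adj] (q : V) : EulerBound G {q} := by
  refine ⟨{q}, fun A hA ⟨a, ha⟩ => ⟨a, hA.1 ha, ha⟩, ?_⟩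
  rw [eulerChar_singleton, card_singleton, Nat.cast_one]

theorem IsUnionOfComponents.inter_filter_adj [DecidableEq V] [DecidableRel G.Adj]
    (hA : IsUnionOfComponents G (X.erase q) A) :
    IsUnionOfComponents G (X.filter (G.Adj q)) (A.filter (G.Adj q)) := by
  refine ⟨filter_subset_filter _ (hA.1.trans (erase_subset _ _)), fun a ha b hb hab => ?_⟩
  rw [mem_filter] at ha hb ⊢
  exact ⟨hA.2 a ha.1 b (mem_erase.2 ⟨hb.2.ne', hb.1⟩) hab, hb.2⟩

theorem IsUnionOfComponents.sdiff [DecidableEq V] (hA : IsUnionOfComponents G X A) :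
    IsUnionOfComponents G X (X \ A) := by
  refine ⟨sdiff_subset, fun a ha b hb hab => ?_⟩
  rw [mem_sdiff] at ha ⊢
  exact ⟨hb, fun hbA => ha.2 (hA.2 b hbA a ha.1 hab.symm)⟩

theorem MeetsComponents.exists_mem_component (hS : MeetsComponents G X S) (hq : q ∈ X) :
    ∃ s ∈ S, ∀ A, IsUnionOfComponents G X A → s ∈ A → q ∈ A := by
  classical
  let K := X.filter fun x => ∀ A, IsUnionOfComponents G X A → q ∈ A → x ∈ A
  have hK : IsUnionOfComponents G X K := by
    refine ⟨filter_subset _ _, fun a ha b hb hab => mem_filter.2 ⟨hb, fun A hA hqA => ?_⟩⟩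
    exact hA.2 a ((mem_filter.1 ha).2 A hA hqA) b hb hab
  obtain ⟨s, hs, hsK⟩ := hS K hK ⟨q, mem_filter.2 ⟨hq, fun _ _ hqA => hqA⟩⟩
  refine ⟨s, hs, fun A hA hsA => ?_⟩
  by_contra hqA
  exact (mem_sdiff.1 ((mem_filter.1 hsK).2 _ hA.sdiff (mem_sdiff.2 ⟨hq, hqA⟩))).2 hsA

variable [DecidableEq V]

theorem IsUnionOfComponents.of_erase (hA : IsUnionOfComponents G (X.erase q) A)
    (hq : ∀ a ∈ A, ¬ G.Adj q a) : IsUnionOfComponents G X A := by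
  refine ⟨hA.1.trans (erase_subset _ _), fun a ha b hb hab => ?_⟩
  refine hA.2 a ha b (mem_erase.2 ⟨?_, hb⟩) hab
  rintro rfl
  exact hq a ha hab.symm

protected theorem IsUnionOfComponents.insert (hA : IsUnionOfComponents G (X.erase q) A) (hq : q ∈ X)
    (hadj : ∀ x ∈ X, G.Adj q x → x ∈ A) : IsUnionOfComponents G X (insert q A) := by
  refine ⟨insert_subset hq (hA.1.trans (erase_subset _ _)), fun a ha b hb hab => ?_⟩
  obtain rfl | ha := mem_insert.1 ha
  · exact mem_insert_of_mem (hadj b hb hab)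
  · by_cases hbq : b = q
    · exact hbq ▸ mem_insert_self b A
    · exact mem_insert_of_mem (hA.2 a ha b (mem_erase.2 ⟨hbq, hb⟩) hab)

protected theorem IsUnionOfComponents.erase (hA : IsUnionOfComponents G (insert q X) A)
    (hq : q ∉ X) : IsUnionOfComponents G X (A.erase q) := by
  refine ⟨subset_insert_iff.1 hA.1, fun a ha b hb hab => mem_erase.2 ⟨?_, ?_⟩⟩
  · exact ne_of_mem_of_not_mem hb hq
  · exact hA.2 a (mem_of_mem_erase ha) b (mem_insert_of_mem hb) hab

protected theorem NoCut.erase (hX : NoCut G X) (hq : q ∈ X)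
    (hcenter : ∃ c ∈ X, G.Adj q c ∧ ∀ x ∈ X, G.Adj q x → x = c ∨ G.Adj c x) :
    NoCut G (X.erase q) := by
  intro A hA hne
  have hqA : q ∉ A := fun h => notMem_erase q X (hA.1 h)
  by_cases hadj : ∀ a ∈ A, ¬ G.Adj q a
  · exact absurd hq (hX A (hA.of_erase hadj) hne ▸ hqA)
  push Not at hadj
  obtain ⟨a, ha, hqa⟩ := hadj
  obtain ⟨c, hc, hqc, hcenter⟩ := hcenter
  have hcA : c ∈ A := by
    obtain rfl | hca := hcenter a (mem_of_mem_erase (hA.1 ha)) hqa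
    exacts [ha, hA.2 a ha c (mem_erase.2 ⟨hqc.ne', hc⟩) hca.symm]
  have hinsert : IsUnionOfComponents G X (insert q A) := hA.insert hq fun x hx hqx => by
    obtain rfl | hcx := hcenter x hx hqx
    exacts [hcA, hA.2 c hcA x (mem_erase.2 ⟨hqx.ne', hx⟩) hcx]
  rw [← hX _ hinsert (insert_nonempty q A), erase_insert hqA]

protected theorem NoHole.erase (hX : NoHole G X) {u z : V} (hu : u ∈ X) (hz : z ∉ X)
    (huz : G.Adj u z) : NoHole G (X.erase u) := by
  intro Y hY
  have hXY : X ⊆ insert u Y := subset_insert_iff.2 hY.1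
  obtain heq | hss := hXY.eq_or_ssubset
  · have huY : u ∈ Y := by
      by_contra huY
      rw [heq, erase_insert huY] at hY
      exact hY.ne rfl
    exact ⟨u, huY, notMem_erase u X, z, fun h => hz (heq ▸ mem_insert_of_mem h), huz⟩
  · obtain ⟨q, hq, hqX, w, hw, hqw⟩ := hX _ hss
    exact ⟨q, mem_of_mem_insert_of_ne hq (ne_of_mem_of_not_mem hu hqX).symm,
      fun h => hqX (mem_of_mem_erase h), w, fun h => hw (mem_insert_of_mem h), hqw⟩

protected theorem MeetsComponents.insert (hS : MeetsComponents G X S) (hq : q ∉ X)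
    (hadj : ∃ x ∈ X, G.Adj q x) : MeetsComponents G (insert q X) S := by
  intro A hA hne
  have hne' : (A.erase q).Nonempty := by
    by_cases hqA : q ∈ A
    · obtain ⟨x, hx, hqx⟩ := hadj
      exact ⟨x, mem_erase.2 ⟨hqx.ne', hA.2 q hqA x (mem_insert_of_mem hx) hqx⟩⟩
    · rwa [erase_eq_of_notMem hqA]
  obtain ⟨s, hs, hsA⟩ := hS _ (hA.erase hq) hne'
  exact ⟨s, hs, mem_of_mem_erase hsA⟩

variable [DecidableRel G.Adj]

theorem filter_adj_erase : (X.erase q).filter (G.Adj q) = X.filter (G.Adj q) := by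
  rw [filter_erase, erase_eq_of_notMem fun h => G.irrefl (mem_filter.1 h).2]

protected theorem MeetsComponents.erase {T : Finset V} {s : V} (hS : MeetsComponents G X S)
    (hs : ∀ A, IsUnionOfComponents G X A → s ∈ A → q ∈ A)
    (hT : MeetsComponents G (X.filter (G.Adj q)) T) :
    MeetsComponents G (X.erase q) (S.erase s ∪ T) := by
  intro A hA hne
  by_cases hqA : ∃ a ∈ A, G.Adj q a
  · obtain ⟨a, ha, hqa⟩ := hqA
    obtain ⟨t, ht, htA⟩ := hT _ hA.inter_filter_adj ⟨a, mem_filter.2 ⟨ha, hqa⟩⟩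
    exact ⟨t, mem_union_right _ ht, (mem_filter.1 htA).1⟩
  · have hAX : IsUnionOfComponents G X A := hA.of_erase (by simpa using hqA)
    obtain ⟨t, ht, htA⟩ := hS A hAX hne
    refine ⟨t, mem_union_left _ (mem_erase.2 ⟨?_, ht⟩), htA⟩
    rintro rfl
    exact notMem_erase q X (hA.1 (hs A hAX htA))

protected theorem EulerBound.erase {T : Finset V} (hX : EulerBound G X) (hq : q ∈ X)
    (hT : MeetsComponents G (X.filter (G.Adj q)) T)
    (hle : #T ≤ graphEulerChar G (X.filter (G.Adj q))) : EulerBound G (X.erase q) := by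
  obtain ⟨S, hS, hSle⟩ := hX
  obtain ⟨s, hs, hsq⟩ := hS.exists_mem_component hq
  refine ⟨S.erase s ∪ T, hS.erase hsq hT, ?_⟩
  have hcard : (#(S.erase s ∪ T) : ℚ) + 1 ≤ #S + #T := by
    have := card_union_le (S.erase s) T
    have := card_erase_add_one hs
    exact_mod_cast (by omega : #(S.erase s ∪ T) + 1 ≤ #S + #T)
  have hχ := eulerChar_insert (G := G) (notMem_erase q X)
  rw [insert_erase hq, filter_adj_erase] at hχ
  linarith

protected theorem EulerBound.insert (hX : EulerBound G X) (hq : q ∉ X) (hadj : ∃ x ∈ X, G.Adj q x)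
    (hχ : graphEulerChar G (X.filter (G.Adj q)) = 1) : EulerBound G (insert q X) := by
  obtain ⟨S, hS, hle⟩ := hX
  refine ⟨S, hS.insert hq hadj, ?_⟩
  rw [eulerChar_insert hq, hχ]
  linarith

end Components

/-! ### Cyclic arcs of directions -/

/-- At most three cyclically consecutive elements of `ZMod 6`. -/
def IsArc (m : Finset (ZMod 6)) : Prop :=
  m = ∅ ∨ ∃ i ∈ m, m ⊆ {i - 1, i, i + 1}

instance : DecidablePred IsArc := fun m => by
  unfold IsArc
  infer_instance

/-- The first elements of the maximal cyclic intervals that make up `m`; there are none if `m` is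
everything. -/
def arcStarts (m : Finset (ZMod 6)) : Finset (ZMod 6) :=
  {i ∈ m | i - 1 ∉ m}

theorem isArc_of_card_add_card_arcStarts_lt :
    ∀ {m : Finset (ZMod 6)}, #m + 2 * #(arcStarts m) < 6 → IsArc m := by
  decide +kernel

theorem IsArc.card_arcStarts :
    ∀ {m : Finset (ZMod 6)}, IsArc m → m.Nonempty → #(arcStarts m) = 1 := by
  decide +kernel

theorem IsArc.ne_univ : ∀ {m : Finset (ZMod 6)}, IsArc m → m ≠ univ := by
  decide +kernel

theorem exists_mem_arcStarts : ∀ {m B : Finset (ZMod 6)}, m ≠ univ → B ⊆ m → B.Nonempty →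
    (∀ i ∈ B, i - 1 ∈ m → i - 1 ∈ B) → ∃ i ∈ arcStarts m, i ∈ B := by
  decide +kernel

theorem sum_sum_consecutive : ∀ m : Finset (ZMod 6),
    ∑ i ∈ m, ∑ j ∈ m, (if j = i + 1 ∨ j = i - 1 then 1 else 0) + 2 * #(arcStarts m) = 2 * #m := by
  decide +kernel

theorem isArc_iff_exists_interval : ∀ {m : Finset (ZMod 6)},
    IsArc m ↔ ∃ i, ∃ k < 4, m = (range k).image fun n : ℕ => i + (n : ZMod 6) := by
  decide +kernel

theorem isArc_iff_card_le_three_and_consecutive {m : Finset (ZMod 6)} :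
    IsArc m ↔ #m ≤ 3 ∧ ∃ (i : ZMod 6) (k : ℕ), ∀ j, j ∈ m ↔ ∃ n : ℕ, n < k ∧ j = i + n := by
  rw [isArc_iff_exists_interval]
  constructor
  · rintro ⟨i, k, hk, rfl⟩
    refine ⟨card_image_le.trans (by rw [card_range]; omega), i, k, fun j => ?_⟩
    simp only [mem_image, mem_range, eq_comm]
  · rintro ⟨hcard, i, k, hm⟩
    refine ⟨i, k, ?_, ?_⟩
    · by_contra! hk
      have hsub : (range 4).image (fun n : ℕ => i + (n : ZMod 6)) ⊆ m := fun j hj => by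
        obtain ⟨n, hn, rfl⟩ := mem_image.1 hj
        exact (hm _).2 ⟨n, (mem_range.1 hn).trans_le hk, rfl⟩
      have hfour : ∀ i : ZMod 6, #((range 4).image fun n : ℕ => i + (n : ZMod 6)) = 4 := by
        decide
      have := card_le_card hsub
      rw [hfour] at this
      omega
    · ext j
      simp only [hm, mem_image, mem_range, eq_comm]

/-! ### The triangular grid -/

/-- The six grid vectors in counterclockwise order. -/
def dir (i : ZMod 6) : Node :=
  (![(1, 0), (0, 1), (-1, 1), (-1, 0), (0, -1), (1, -1)] : Fin 6 → Node) i

theorem dir_injective : Function.Injective dir := by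
  unfold Function.Injective
  decide

theorem dir_add_dir_add_three : ∀ i, dir i + dir (i + 3) = 0 := by
  decide

theorem dir_sub_dir_eq_dir_iff : ∀ i j, (∃ k, dir j = dir i + dir k) ↔ j = i + 1 ∨ j = i - 1 := by
  decide

theorem adj_iff {p q : Node} : triGrid.Adj p q ↔ ∃ i, q = p + dir i := by
  have hdir (v : Node) : v ∈ ({(1, 0), (0, 1), (-1, 1), (-1, 0), (0, -1), (1, -1)} : Set Node) ↔
      ∃ i, v = dir i := by
    constructor
    · rintro (h | h | h | h | h | h)
      exacts [⟨0, h⟩, ⟨1, h⟩, ⟨2, h⟩, ⟨3, h⟩, ⟨4, h⟩, ⟨5, h⟩]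
    · rintro ⟨i, rfl⟩
      revert i
      simp only [Set.mem_insert_iff, Set.mem_singleton_iff]
      decide
  exact (hdir (q - p)).trans (exists_congr fun i => sub_eq_iff_eq_add')

instance : DecidableRel triGrid.Adj := fun _ _ => decidable_of_iff _ adj_iff.symm

theorem adj_dir (p : Node) (i : ZMod 6) : triGrid.Adj p (p + dir i) :=
  adj_iff.2 ⟨i, rfl⟩

theorem add_dir_injective (p : Node) : Function.Injective fun i => p + dir i :=
  (add_right_injective p).comp dir_injective

theorem eq_add_dir_iff {p q : Node} {i : ZMod 6} : q = p + dir i ↔ p = q + dir (i + 3) := by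
  rw [← sub_eq_iff_eq_add, ← neg_eq_of_add_eq_zero_right (dir_add_dir_add_three i)]
  grind

theorem adj_dir_dir {p : Node} {i j : ZMod 6} :
    triGrid.Adj (p + dir i) (p + dir j) ↔ j = i + 1 ∨ j = i - 1 := by
  simp only [adj_iff, add_assoc, add_right_inj, dir_sub_dir_eq_dir_iff]

theorem isArc_iff_exists_center {f : ZMod 6 → Node}
    (hf : ∀ i j, triGrid.Adj (f i) (f j) ↔ j = i + 1 ∨ j = i - 1) {m : Finset (ZMod 6)} :
    IsArc m ↔ m = ∅ ∨ ∃ i ∈ m, ∀ j ∈ m, j = i ∨ triGrid.Adj (f i) (f j) := by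
  simp only [IsArc, subset_iff, mem_insert, mem_singleton, hf]
  refine or_congr_right (exists_congr fun i => and_congr_right fun _ => forall₂_congr fun j _ => ?_)
  tauto

theorem not_adj_of_adj_of_adj {p q r s : Node} (hpq : triGrid.Adj p q) (hpr : triGrid.Adj p r)
    (hps : triGrid.Adj p s) (hqr : triGrid.Adj q r) (hrs : triGrid.Adj r s) :
    ¬ triGrid.Adj q s := by
  have hdir : ∀ i j k : ZMod 6, (j = i + 1 ∨ j = i - 1) → (k = j + 1 ∨ k = j - 1) →
      ¬ (k = i + 1 ∨ k = i - 1) := by decide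
  obtain ⟨i, rfl⟩ := adj_iff.1 hpq
  obtain ⟨j, rfl⟩ := adj_iff.1 hpr
  obtain ⟨k, rfl⟩ := adj_iff.1 hps
  rw [adj_dir_dir] at hqr hrs ⊢
  exact hdir i j k hqr hrs

open Classical in
/-- The directions in which `p` has a neighbour that belongs to `s`. -/
noncomputable def directions (p : Node) (s : Set Node) : Finset (ZMod 6) :=
  {i | p + dir i ∈ s}

theorem mem_directions {p : Node} {s : Set Node} {i : ZMod 6} :
    i ∈ directions p s ↔ p + dir i ∈ s := by
  simp only [directions, mem_filter, mem_univ, true_and]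

theorem image_directions {N : Finset Node} {p : Node} (hN : ∀ q ∈ N, triGrid.Adj p q) :
    (directions p N).image (fun i => p + dir i) = N := by
  ext q
  simp only [mem_image, mem_directions, mem_coe]
  constructor
  · rintro ⟨i, hi, rfl⟩
    exact hi
  · intro hq
    obtain ⟨i, rfl⟩ := adj_iff.1 (hN q hq)
    exact ⟨i, hq, rfl⟩

theorem isArc_iff_exists_center_of_enum {p : Node} {f : ZMod 6 → Node}
    (hadj : ∀ i j, triGrid.Adj (f i) (f j) ↔ j = i + 1 ∨ j = i - 1)
    (hf : ∀ q, triGrid.Adj p q ↔ ∃ i, q = f i) {s : Set Node} {m : Finset (ZMod 6)}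
    (hm : ∀ i, i ∈ m ↔ f i ∈ s) :
    IsArc m ↔ (∀ q ∈ s, ¬ triGrid.Adj p q) ∨
      ∃ c ∈ s, triGrid.Adj p c ∧ ∀ q ∈ s, triGrid.Adj p q → q = c ∨ triGrid.Adj c q := by
  have heq : ∀ i j : ZMod 6, (i + 1 = j + 1 ∨ i + 1 = j - 1) → (i - 1 = j + 1 ∨ i - 1 = j - 1) →
      i = j := by decide
  have hinj : Function.Injective f := fun i j hij => by
    have hnext := (hadj i (i + 1)).2 (.inl rfl)
    have hprev := (hadj i (i - 1)).2 (.inr rfl)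
    rw [hij, hadj] at hnext hprev
    exact heq i j hnext hprev
  rw [isArc_iff_exists_center hadj, eq_empty_iff_forall_notMem]
  simp only [hf, hm]
  grind [hinj.eq_iff]

theorem isArc_directions_iff {p : Node} {s : Set Node} :
    IsArc (directions p s) ↔ (∀ q ∈ s, ¬ triGrid.Adj p q) ∨
      ∃ c ∈ s, triGrid.Adj p c ∧ ∀ q ∈ s, triGrid.Adj p q → q = c ∨ triGrid.Adj c q :=
  isArc_iff_exists_center_of_enum (fun _ _ => adj_dir_dir) (fun _ => adj_iff)
    fun _ => mem_directions

theorem card_directions {N : Finset Node} {p : Node} (hN : ∀ q ∈ N, triGrid.Adj p q) :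
    #(directions p N) = #N := by
  conv_rhs => rw [← image_directions hN]
  rw [card_image_of_injective _ (add_dir_injective p)]

theorem graphEulerChar_eq_card_arcStarts {N : Finset Node} {p : Node}
    (hN : ∀ q ∈ N, triGrid.Adj p q) :
    graphEulerChar triGrid N = #(arcStarts (directions p N)) := by
  have hinj := add_dir_injective p
  have hsum := sum_sum_consecutive (directions p N)
  conv_lhs => rw [← image_directions hN, graphEulerChar, card_image_of_injective _ hinj]
  simp only [sum_image hinj.injOn, adj_dir_dir]
  have := congrArg (Nat.cast (R := ℚ)) hsum
  push_cast at this
  linarith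

theorem directions_filter_adj (X : Finset Node) (p : Node) :
    directions p (X.filter (triGrid.Adj p)) = directions p X := by
  ext i
  simp only [mem_directions, mem_coe, mem_filter, adj_dir, and_true]

theorem graphEulerChar_filter_adj (X : Finset Node) (p : Node) :
    graphEulerChar triGrid (X.filter (triGrid.Adj p)) = #(arcStarts (directions p X)) := by
  rw [graphEulerChar_eq_card_arcStarts fun q hq => (mem_filter.1 hq).2, directions_filter_adj]

theorem exists_adj_iff_directions_nonempty {X : Finset Node} {p : Node} :
    (∃ q ∈ X, triGrid.Adj p q) ↔ (directions p X).Nonempty := by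
  constructor
  · rintro ⟨q, hq, hpq⟩
    obtain ⟨i, rfl⟩ := adj_iff.1 hpq
    exact ⟨i, mem_directions.2 hq⟩
  · rintro ⟨i, hi⟩
    exact ⟨_, mem_directions.1 hi, adj_dir p i⟩

theorem directions_subset_of_forall_toLex_le {X : Finset Node} {u : Node}
    (hmax : ∀ x ∈ X, toLex x ≤ toLex u) : directions u X ⊆ {2, 3, 4} := by
  intro i hi
  have hle := hmax _ (mem_directions.1 hi)
  contrapose! hle
  have hpos : ∀ i : ZMod 6, i ∉ ({2, 3, 4} : Finset (ZMod 6)) → 0 < toLex (dir i) := by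
    simp only [Prod.Lex.lt_iff]
    decide
  rw [toLex_add]
  exact lt_add_of_pos_right _ (hpos i hle)

/-! ### Euler characteristics in the triangular grid -/

theorem meetsComponents_arcStarts {X : Finset Node} {p : Node} (hp : directions p X ≠ univ) :
    MeetsComponents triGrid (X.filter (triGrid.Adj p))
      ((arcStarts (directions p X)).image fun i => p + dir i) := by
  intro A hA hne
  have hAX : directions p A ⊆ directions p X := fun i hi =>
    mem_directions.2 (mem_filter.1 (hA.1 (mem_directions.1 hi))).1
  have hAne : (directions p A).Nonempty :=
    exists_adj_iff_directions_nonempty.1 <|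
      hne.imp fun a ha => ⟨ha, (mem_filter.1 (hA.1 ha)).2⟩
  have hclosed : ∀ i ∈ directions p A, i - 1 ∈ directions p X → i - 1 ∈ directions p A := by
    simp only [mem_directions]
    exact fun i hi hi' => hA.2 _ hi _ (mem_filter.2 ⟨hi', adj_dir _ _⟩) (adj_dir_dir.2 (Or.inr rfl))
  obtain ⟨i, hi, hiA⟩ := exists_mem_arcStarts hp hAX hAne hclosed
  exact ⟨_, mem_image_of_mem _ hi, mem_directions.1 hiA⟩

theorem eulerBound_erase {X : Finset Node} {p : Node} (hX : EulerBound triGrid X) (hp : p ∈ X)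
    (hdir : directions p X ≠ univ) : EulerBound triGrid (X.erase p) := by
  refine hX.erase hp (meetsComponents_arcStarts hdir) ?_
  rw [graphEulerChar_filter_adj]
  exact_mod_cast card_image_le

theorem graphEulerChar_filter_adj_eq_one {X : Finset Node} {p : Node}
    (harc : IsArc (directions p X)) (hne : (directions p X).Nonempty) :
    graphEulerChar triGrid (X.filter (triGrid.Adj p)) = 1 := by
  rw [graphEulerChar_filter_adj, harc.card_arcStarts hne, Nat.cast_one]

theorem directions_erase (X : Finset Node) (p : Node) :
    directions p (X.erase p : Finset Node) = directions p X := by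
  rw [← directions_filter_adj, filter_adj_erase, directions_filter_adj]

theorem eulerBound_of_erase {X : Finset Node} {p : Node} (hX : EulerBound triGrid (X.erase p))
    (hp : p ∈ X) (harc : IsArc (directions p X)) (hne : (directions p X).Nonempty) :
    EulerBound triGrid X := by
  rw [← insert_erase hp]
  refine hX.insert (notMem_erase p X) ?_ ?_
  · rwa [exists_adj_iff_directions_nonempty, directions_erase]
  · rw [filter_adj_erase, graphEulerChar_filter_adj_eq_one harc hne]

theorem directions_ne_univ_of_adj {X : Finset Node} {q z : Node} (hz : z ∉ X)
    (hqz : triGrid.Adj q z) : directions q X ≠ univ := by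
  obtain ⟨i, rfl⟩ := adj_iff.1 hqz
  exact fun h => hz (mem_directions.1 (h ▸ mem_univ i))

/-- A comb: a column with a horizontal tooth of arbitrary length attached to each of its nodes. -/
def IsComb (c : ℤ) (X : Finset Node) : Prop :=
  ∀ p ∈ X, c ≤ p.1 ∧ c ≤ p.2 ∧ (c < p.1 → p + dir 3 ∈ X) ∧
    (p.1 = c → c < p.2 → p + dir 4 ∈ X)

protected theorem IsComb.erase {c : ℤ} {X : Finset Node} {u : Node} (hX : IsComb c X)
    (hu : directions u X ⊆ {2, 3, 4}) : IsComb c (X.erase u) := by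
  intro p hp
  have hpX := mem_of_mem_erase hp
  obtain ⟨hx, hy, h₃, h₄⟩ := hX p hpX
  have hback {i : ZMod 6} (hi : i + 3 ∉ ({2, 3, 4} : Finset (ZMod 6))) : p + dir i ≠ u := fun h =>
    hi (hu (mem_directions.2 (eq_add_dir_iff.1 h.symm ▸ hpX)))
  exact ⟨hx, hy, fun h => mem_erase.2 ⟨hback (by decide), h₃ h⟩,
    fun h h' => mem_erase.2 ⟨hback (by decide), h₄ h h'⟩⟩

theorem IsComb.directions_of_fst_eq {c : ℤ} {X : Finset Node} {u : Node} (hX : IsComb c X)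
    (hdir : directions u X ⊆ {2, 3, 4}) (hu : u.1 = c) : directions u X ⊆ {4} := by
  have hleft {i : ZMod 6} (hi : (dir i).1 = -1) : i ∉ directions u X := fun h => by
    have := (hX _ (mem_directions.1 h)).1
    rw [Prod.fst_add, hi] at this
    omega
  intro i hi
  have := hdir hi
  simp only [mem_insert, mem_singleton] at this ⊢
  obtain rfl | rfl | rfl := this
  exacts [absurd hi (hleft rfl), absurd hi (hleft rfl), rfl]

theorem IsComb.eulerBound {c : ℤ} {X : Finset Node} (hX : IsComb c X) (hne : X.Nonempty) :
    EulerBound triGrid X := by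
  induction X using Finset.strongInduction with
  | H X ih =>
    obtain ⟨u, hu, hmax⟩ := X.exists_max_image (fun x : Node => toLex x) hne
    have hdir := directions_subset_of_forall_toLex_le hmax
    obtain ⟨-, hy, h₃, h₄⟩ := hX u hu
    have hstep {i : ZMod 6} (hi : u + dir i ∈ X) (harc : directions u X ⊆ {i - 1, i, i + 1}) :
        EulerBound triGrid X :=
      have hi' := mem_directions.2 hi
      eulerBound_of_erase (ih _ (erase_ssubset hu) (hX.erase hdir)
        ⟨_, mem_erase.2 ⟨(adj_dir u i).ne', hi⟩⟩) hu (Or.inr ⟨i, hi', harc⟩) ⟨i, hi'⟩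
    obtain hx | hx := (hX u hu).1.lt_or_eq
    · exact hstep (h₃ hx) hdir
    obtain hy | hy := hy.lt_or_eq
    · exact hstep (h₄ hx.symm hy) ((hX.directions_of_fst_eq hdir hx.symm).trans (by decide))
    · suffices X = {u} by
        rw [this]
        exact eulerBound_singleton u
      refine eq_singleton_iff_unique_mem.2 ⟨hu, fun p hp => ?_⟩
      have hle := Prod.Lex.toLex_le_toLex.1 (hmax p hp)
      have := hX p hp
      exact Prod.ext (by omega) (by omega)

theorem exists_eulerBound_superset (X : Finset Node) : ∃ Y, X ⊆ Y ∧ EulerBound triGrid Y := by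
  let N : ℕ := X.sup fun x => x.1.natAbs + x.2.natAbs
  have hmem {x : Node} : x ∈ Icc (-N : ℤ) N ×ˢ Icc (-N : ℤ) N ↔
      (-N ≤ x.1 ∧ x.1 ≤ N) ∧ -N ≤ x.2 ∧ x.2 ≤ N := by
    simp only [mem_product, mem_Icc]
  refine ⟨Icc (-N : ℤ) N ×ˢ Icc (-N : ℤ) N, fun x hx => ?_, IsComb.eulerBound (c := -N) ?_ ?_⟩
  · have : x.1.natAbs + x.2.natAbs ≤ N := le_sup (f := fun x : Node => x.1.natAbs + x.2.natAbs) hx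
    rw [hmem]
    omega
  · have hdir : dir 3 = (-1, 0) ∧ dir 4 = (0, -1) := by decide
    intro p hp
    simp only [hmem, hdir, Prod.fst_add, Prod.snd_add] at hp ⊢
    omega
  · exact ⟨0, hmem.2 (by simp)⟩

theorem NoHole.eulerBound {X : Finset Node} (hX : NoHole triGrid X) : EulerBound triGrid X := by
  obtain ⟨Y, hXY, hY⟩ := exists_eulerBound_superset X
  induction Y using Finset.strongInduction with
  | H Y ih =>
    obtain rfl | hss := hXY.eq_or_ssubset
    · exact hY
    · obtain ⟨q, hq, hqX, z, hz, hqz⟩ := hX Y hss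
      exact ih _ (erase_ssubset hq) (subset_erase.2 ⟨hXY, hqX⟩)
        (eulerBound_erase hY hq (directions_ne_univ_of_adj hz hqz))

theorem NoHole.exists_isArc {X : Finset Node} (hX : NoHole triGrid X) (hne : X.Nonempty) :
    ∃ u ∈ X, IsArc (directions u X) := by
  obtain ⟨S, hS, hle⟩ := hX.eulerBound
  obtain ⟨s, hs, -⟩ := hS X ⟨Subset.rfl, fun _ _ b hb _ => hb⟩ hne
  have hpos : 0 < eulerChar triGrid X := hle.trans_lt' (by exact_mod_cast card_pos.2 ⟨s, hs⟩)
  rw [eulerChar_eq_sum_curvature] at hpos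
  obtain ⟨u, hu, hcurv⟩ :=
    exists_lt_of_sum_lt (f := fun _ => (0 : ℚ)) (sum_const_zero.trans_lt hpos)
  refine ⟨u, hu, isArc_of_card_add_card_arcStarts_lt ?_⟩
  rw [graphEulerChar_filter_adj, ← card_directions fun q hq => (mem_filter.1 hq).2,
    directions_filter_adj] at hcurv
  have : (#(directions u X) + 2 * #(arcStarts (directions u X)) : ℚ) < 6 := by linarith
  exact_mod_cast this

theorem NoHole.erase_of_isArc {X : Finset Node} (hX : NoHole triGrid X) {u : Node} (hu : u ∈ X)
    (harc : IsArc (directions u X)) : NoHole triGrid (X.erase u) := by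
  obtain ⟨i, hi⟩ : ∃ i, i ∉ directions u X := by
    simpa only [ne_eq, eq_univ_iff_forall, not_forall] using harc.ne_univ
  exact hX.erase hu (fun h => hi (mem_directions.2 h)) (adj_dir u i)

theorem NoHole.eulerChar_eq_one {X : Finset Node} (hX : NoHole triGrid X) (hcut : NoCut triGrid X)
    (hne : X.Nonempty) : eulerChar triGrid X = 1 := by
  induction X using Finset.strongInduction with
  | H X ih =>
    obtain ⟨u, hu, harc⟩ := hX.exists_isArc hne
    obtain hisolated | ⟨c, hc, huc, hcenter⟩ := isArc_directions_iff.1 harc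
    · have hX : {u} = X := hcut {u}
        ⟨singleton_subset_iff.2 hu, fun a ha b hb hab =>
          absurd (mem_singleton.1 ha ▸ hab) (hisolated b hb)⟩ (singleton_nonempty u)
      rw [← hX, eulerChar_singleton]
    · have hχ := eulerChar_insert (G := triGrid) (notMem_erase u X)
      rw [insert_erase hu, filter_adj_erase, graphEulerChar_filter_adj_eq_one harc
        (exists_adj_iff_directions_nonempty.1 ⟨c, hc, huc⟩), add_sub_cancel_right] at hχ
      rw [hχ]
      exact ih _ (erase_ssubset hu) (hX.erase_of_isArc hu harc)
        (hcut.erase hu ⟨c, hc, huc, hcenter⟩) ⟨c, mem_erase.2 ⟨huc.ne', hc⟩⟩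

/-! ### Orientations of the triangular grid -/

theorem existsUnique_sink_of_orientation {X : Finset Node} {O : Node → Node → Prop}
    (hX : NoHole triGrid X) (hcut : NoCut triGrid X) (hne : X.Nonempty)
    (hadj : ∀ p q, O p q → triGrid.Adj p q) (hasymm : ∀ p q, O p q → ¬ O q p)
    (htotal : ∀ p ∈ X, ∀ q ∈ X, triGrid.Adj p q → O p q ∨ O q p)
    (hacyclic : ∀ p q r, ¬ (O p q ∧ O q r ∧ O r p)) (hmem : ∀ p q, O p q → q ∈ X)
    (harc : ∀ p ∈ X, IsArc (directions p {q | O p q})) :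
    ∃! p, p ∈ X ∧ ∀ q, ¬ O p q := by
  classical
  have hout (p : Node) : directions p (X.filter (O p)) = directions p {q | O p q} := by
    ext i
    simp only [mem_directions, mem_coe, mem_filter, Set.mem_ofPred_eq, and_iff_right_iff_imp]
    exact hmem p _
  have hindex (p : Node) (hp : p ∈ X) :
      1 - graphEulerChar triGrid (X.filter (O p)) = if ∀ q, ¬ O p q then 1 else 0 := by
    rw [graphEulerChar_eq_card_arcStarts fun q hq => hadj p q (mem_filter.1 hq).2, hout]
    split_ifs with hsink
    · have : directions p {q | O p q} = ∅ := by
        simp only [eq_empty_iff_forall_notMem, mem_directions, Set.mem_ofPred_eq, hsink,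
          not_false_eq_true, implies_true]
      simp only [this, arcStarts, filter_empty, card_empty, Nat.cast_zero, sub_zero]
    · push Not at hsink
      obtain ⟨q, hq⟩ := hsink
      obtain ⟨i, rfl⟩ := adj_iff.1 (hadj p q hq)
      rw [(harc p hp).card_arcStarts ⟨i, mem_directions.2 hq⟩, Nat.cast_one, sub_self]
  have hcount : #{p ∈ X | ∀ q, ¬ O p q} = 1 := by
    have hχ := eulerChar_eq_sum_of_orientation hadj hasymm htotal hacyclic
    rw [hX.eulerChar_eq_one hcut hne, sum_congr rfl hindex, sum_boole] at hχ
    exact_mod_cast hχ.symm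
  simpa only [card_eq_one_iff_existsUnique, mem_filter] using hcount

/-- The lexicographically largest node `w` of `W` has at least three neighbours outside `W`, and its
edges to these use up its outgoing arc. So all edges from the rest of `W` to `w` are directed
towards `w`, and `w` can be removed. -/
theorem eq_empty_of_outward {O : Node → Node → Prop} {W : Finset Node}
    (harc : ∀ w ∈ W, IsArc (directions w {v | O w v}))
    (hboundary : ∀ w ∈ W, ∀ v, triGrid.Adj w v → v ∉ W → O w v)
    (htotal : ∀ w ∈ W, ∀ v ∈ W, triGrid.Adj w v → O w v ∨ O v w) : W = ∅ := by
  induction W using Finset.strongInduction with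
  | H W ih =>
    by_contra hne
    obtain ⟨w, hw, hmax⟩ :=
      W.exists_max_image (fun x : Node => toLex x) (nonempty_iff_ne_empty.2 hne)
    have hcard : #(directions w W) ≤ 3 :=
      (card_le_card (directions_subset_of_forall_toLex_le hmax)).trans (by decide)
    have hcompl : (directions w W)ᶜ = directions w {v | O w v} := by
      refine eq_of_subset_of_card_le (fun i hi => mem_directions.2 ?_) ?_
      · exact hboundary w hw _ (adj_dir w i) fun h => mem_compl.1 hi (mem_directions.2 h)
      · have := (isArc_iff_card_le_three_and_consecutive.1 (harc w hw)).1
        rw [card_compl, ZMod.card]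
        omega
    have hin {i : ZMod 6} (hi : w + dir i ∈ W) : ¬ O w (w + dir i) := fun h =>
      mem_compl.1 (hcompl ▸ mem_directions.2 h) (mem_directions.2 hi)
    obtain ⟨v, hv, hwv⟩ : ∃ v ∈ W, triGrid.Adj w v := by
      rw [exists_adj_iff_directions_nonempty, nonempty_iff_ne_empty]
      intro hempty
      rw [hempty, compl_empty] at hcompl
      exact (harc w hw).ne_univ hcompl.symm
    refine ne_empty_of_mem (mem_erase.2 ⟨hwv.ne', hv⟩) (ih _ (erase_ssubset hw)
      (fun v hv => harc v (mem_of_mem_erase hv)) (fun v hv x hvx hx => ?_)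
      (fun v hv x hx => htotal v (mem_of_mem_erase hv) x (mem_of_mem_erase hx)))
    have hvW := mem_of_mem_erase hv
    by_cases hxw : x = w
    · subst hxw
      obtain ⟨i, rfl⟩ := adj_iff.1 hvx.symm
      exact (htotal x hw _ hvW (adj_dir x i)).resolve_left (hin hvW)
    · exact hboundary v hvW x hvx fun h => hx (mem_erase.2 ⟨hxw, h⟩)

/-! ### Port labellings -/

theorem adj_port_port (L : PortLabelling) (p : Node) (i j : ZMod 6) :
    triGrid.Adj (L.port p i) (L.port p j) ↔ j = i + 1 ∨ j = i - 1 := by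
  have hdir (k : ZMod 6) : ∃ l, (L.port p k : Node) = p + dir l := adj_iff.1 (L.port p k).2
  choose e he using hdir
  have hinj : Function.Injective e := fun k l h =>
    (L.port p).injective (Subtype.val_injective (by rw [he, he, h]))
  have hadj (k l : ZMod 6) : triGrid.Adj (L.port p k) (L.port p l) ↔
      e l = e k + 1 ∨ e l = e k - 1 := by
    rw [he, he, adj_dir_dir]
  have hnext : triGrid.Adj (L.port p i) (L.port p (i + 1)) := L.consecutive p i
  have hprev : triGrid.Adj (L.port p i) (L.port p (i - 1)) := by
    simpa only [sub_add_cancel] using (L.consecutive p (i - 1)).symm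
  constructor
  · have hne : ∀ k : ZMod 6, k + 1 ≠ k - 1 := by decide
    have hne := hinj.ne (hne i)
    rw [hadj] at hnext hprev ⊢
    rw [← hinj.eq_iff, ← hinj.eq_iff (b := i - 1)]
    grind
  · rintro (rfl | rfl)
    exacts [hnext, hprev]

namespace Config

variable {L : PortLabelling} {C D : Config} {b p q r u v : Node} {X : Finset Node}

/-! ### Claimed edges -/

/-- `p` marks its edge to `q` as outgoing, whether or not `q` agrees. -/
def Claims (C : Config) (p q : Node) : Prop :=
  C.link p q = Link.out

theorem Claims.left_mem (h : C.Claims p q) : p ∈ C.support :=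
  (C.mem_of_out p q h).1

theorem Claims.right_mem (h : C.Claims p q) : q ∈ C.support :=
  (C.mem_of_out p q h).2.1

theorem Claims.adj (h : C.Claims p q) : triGrid.Adj p q :=
  (C.mem_of_out p q h).2.2

theorem link_eq_inn_iff : C.link p q = Link.inn ↔ ¬ C.Claims p q := by
  unfold Claims
  cases C.link p q <;> simp

theorem outgoing_iff : C.Outgoing p q ↔ C.Claims p q ∧ ¬ C.Claims q p := by
  rw [Outgoing, link_eq_inn_iff]
  rfl

theorem undirected_iff : C.Undirected p q ↔
    p ∈ C.support ∧ q ∈ C.support ∧ triGrid.Adj p q ∧ ¬ C.Claims p q ∧ ¬ C.Claims q p := by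
  simp only [Undirected, link_eq_inn_iff]

theorem Undirected.symm (h : C.Undirected p q) : C.Undirected q p :=
  ⟨h.2.1, h.1, h.2.2.1.symm, h.2.2.2.2, h.2.2.2.1⟩

theorem Outgoing.adj (h : C.Outgoing p q) : triGrid.Adj p q :=
  Claims.adj h.1

theorem link_eq_link_iff :
    C.link p q = D.link u v ↔ (C.Claims p q ↔ D.Claims u v) := by
  unfold Claims
  cases C.link p q <;> cases D.link u v <;> simp

theorem ext_claims (hsupp : C.support = D.support)
    (hclaims : ∀ u v, C.Claims u v ↔ D.Claims u v) : C = D :=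
  Config.ext hsupp (funext₂ fun u v => link_eq_link_iff.2 (hclaims u v))

theorem isArc_outgoing_iff (L : PortLabelling) (C : Config) (p : Node) :
    IsArc (directions p {q | C.Outgoing p q}) ↔ C.R2 p ∧ C.R3 L p := by
  classical
  set ports : Finset (ZMod 6) := {i | C.Outgoing p (L.port p i)}
  have hports (i : ZMod 6) : i ∈ ports ↔ C.Outgoing p (L.port p i) := by
    simp only [ports, mem_filter, mem_univ, true_and]
  have hport (q : Node) : triGrid.Adj p q ↔ ∃ i, q = L.port p i :=
    ⟨fun h => ⟨(L.port p).symm ⟨q, h⟩, by rw [Equiv.apply_symm_apply]⟩, by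
      rintro ⟨i, rfl⟩
      exact (L.port p i).2⟩
  have hcard : #ports = {q | C.Outgoing p q}.ncard := by
    have himage : {q | C.Outgoing p q} = (fun i => (L.port p i : Node)) '' ports := by
      ext q
      simp only [Set.mem_image, mem_coe, hports, Set.mem_ofPred_eq]
      constructor
      · intro hq
        obtain ⟨i, rfl⟩ := (hport q).1 hq.adj
        exact ⟨i, hq, rfl⟩
      · rintro ⟨i, hi, rfl⟩
        exact hi
    have hinj : Function.Injective fun i => (L.port p i : Node) :=
      Subtype.val_injective.comp (L.port p).injective
    rw [himage, Set.ncard_image_of_injective _ hinj, Set.ncard_coe_finset]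
  rw [isArc_directions_iff,
    ← isArc_iff_exists_center_of_enum (m := ports) (adj_port_port L p) hport hports,
    isArc_iff_card_le_three_and_consecutive, hcard]
  simp only [hports, R2, R3]

/-! ### The execution of the algorithm by one particle -/

/-- The edge `pq` is not claimed by `q`, so that `p` may claim it. -/
def Candidate (C : Config) (p q : Node) : Prop :=
  p ∈ C.support ∧ q ∈ C.support ∧ triGrid.Adj p q ∧ ¬ C.Claims q p

/-- R2, R3 and R4 hold at `p` once `p` claims all its candidates. -/
def Accepts (C : Config) (p : Node) : Prop :=
  IsArc (directions p {q | C.Candidate p q}) ∧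
    ∀ q r, ¬ (C.Candidate p q ∧ C.Outgoing q r ∧ C.Claims r p)

/-- No edge of `p` is claimed by both of its endpoints. -/
def NoConflictAt (C : Config) (p : Node) : Prop :=
  ∀ q, C.Claims p q → ¬ C.Claims q p

theorem Candidate.claims_or_undirected (h : C.Candidate p q) :
    C.Claims p q ∨ C.Undirected p q := by
  rw [undirected_iff]
  unfold Candidate at h
  tauto

theorem NoConflictAt.outgoing_iff_claims (h : C.NoConflictAt p) :
    C.Outgoing p q ↔ C.Claims p q := by
  rw [outgoing_iff, and_iff_left_of_imp (h q)]

theorem NoConflictAt.candidate_iff (h : C.NoConflictAt p) :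
    C.Candidate p q ↔ C.Claims p q ∨ C.Undirected p q := by
  refine ⟨Candidate.claims_or_undirected, ?_⟩
  rintro (hq | hq)
  · exact ⟨hq.left_mem, hq.right_mem, hq.adj, h q hq⟩
  · rw [undirected_iff] at hq
    exact ⟨hq.1, hq.2.1, hq.2.2.1, hq.2.2.2.2⟩

theorem claims_write_self {reg : Node → Link} :
    (C.write p reg).Claims p v ↔
      (p ∈ C.support ∧ v ∈ C.support ∧ triGrid.Adj p v) ∧ reg v = Link.out := by
  simp only [Claims, write, if_true]
  split_ifs with h <;> simp [h]

theorem claims_write_of_ne {reg : Node → Link} (h : u ≠ p) :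
    (C.write p reg).Claims u v ↔ C.Claims u v := by
  simp only [Claims, write, h, if_false]

theorem claims_resolve_self : (C.resolve p).Claims p v ↔ C.Outgoing p v := by
  rw [resolve, claims_write_self, outgoing_iff]
  have := C.mem_of_out p v
  by_cases h : C.Conflicting p v <;> simp only [Conflicting, Claims] at h ⊢ <;> grind

theorem claims_resolve_of_ne (h : u ≠ p) : (C.resolve p).Claims u v ↔ C.Claims u v :=
  claims_write_of_ne h

theorem noConflictAt_resolve : (C.resolve p).NoConflictAt p := fun q hq => by
  rw [claims_resolve_of_ne hq.adj.ne']
  exact (outgoing_iff.1 (claims_resolve_self.1 hq)).2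

theorem candidate_resolve_self : (C.resolve p).Candidate p q ↔ C.Candidate p q :=
  and_congr_right fun _ => and_congr_right fun _ => and_congr_right fun hpq =>
    not_congr (claims_resolve_of_ne hpq.ne')

theorem claims_line1_of_ne (h : u ≠ p) : (C.line1 p).Claims u v ↔ C.Claims u v := by
  unfold line1
  split_ifs
  · rfl
  · exact claims_write_of_ne h

theorem R1.not_undirected (h : C.R1 p) : ¬ C.Undirected p q := by
  intro hq
  have := h q hq.2.1 hq.2.2.1
  simp only [outgoing_iff, undirected_iff] at this hq
  tauto

theorem NoConflictAt.claims_line1_self (h : C.NoConflictAt p) :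
    (C.line1 p).Claims p v ↔ C.Candidate p v := by
  rw [h.candidate_iff]
  unfold line1
  split_ifs with hR1
  · rw [or_iff_left hR1.not_undirected]
  · rw [claims_write_self]
    split_ifs with hv
    · exact iff_of_true ⟨⟨hv.1, hv.2.1, hv.2.2.1⟩, rfl⟩ (.inr hv)
    · rw [or_iff_left hv]
      exact and_iff_right_of_imp (C.mem_of_out p v)

theorem claims_line2_of_ne (h : u ≠ p) : (C.line2 L p).Claims u v ↔ C.Claims u v := by
  unfold line2
  split_ifs
  · exact claims_write_of_ne h
  · rfl

theorem NoConflictAt.claims_line2_self (h : C.NoConflictAt p) :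
    (C.line2 L p).Claims p v ↔ C.Claims p v ∧ C.R2 p ∧ C.R3 L p ∧ C.R4 p := by
  unfold line2
  split_ifs with hfail
  · refine iff_of_false (fun hv => ?_) (by tauto)
    rw [claims_write_self] at hv
    split_ifs at hv with hout
    · simp at hv
    · exact hout (h.outgoing_iff_claims.2 hv.2)
  · push Not at hfail
    exact (and_iff_left hfail).symm

/-- `D` arises from `C` when `p` claims exactly its candidates. -/
def ClaimsCandidates (C D : Config) (p : Node) : Prop :=
  (∀ v, D.Claims p v ↔ C.Candidate p v) ∧ ∀ u v, u ≠ p → (D.Claims u v ↔ C.Claims u v)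

theorem claimsCandidates_line1_resolve (C : Config) (p : Node) :
    C.ClaimsCandidates ((C.resolve p).line1 p) p :=
  ⟨fun _ => noConflictAt_resolve.claims_line1_self.trans candidate_resolve_self,
    fun _ _ hu => (claims_line1_of_ne hu).trans (claims_resolve_of_ne hu)⟩

namespace ClaimsCandidates

theorem noConflictAt (h : C.ClaimsCandidates D p) : D.NoConflictAt p := fun q hq => by
  rw [h.2 q p hq.adj.ne']
  exact ((h.1 q).1 hq).2.2.2

theorem outgoing_self_iff (h : C.ClaimsCandidates D p) : D.Outgoing p q ↔ C.Candidate p q := by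
  rw [h.noConflictAt.outgoing_iff_claims, h.1]

theorem r4_iff (h : C.ClaimsCandidates D p) :
    D.R4 p ↔ ∀ q r, ¬ (C.Candidate p q ∧ C.Outgoing q r ∧ C.Claims r p) := by
  refine forall₂_congr fun q r => not_congr ?_
  rw [h.outgoing_self_iff]
  refine and_congr_right fun hq => ?_
  have hqp : q ≠ p := hq.2.2.1.ne'
  simp only [outgoing_iff, h.2 q r hqp]
  by_cases hrp : r = p
  · subst hrp
    exact iff_of_false (fun hr => hq.2.2.2 hr.1.1) (fun hr => hq.2.2.2 hr.1.1)
  · rw [h.2 r q hrp, h.2 r p hrp, h.1 r]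
    unfold Candidate
    tauto

theorem accepts_iff (h : C.ClaimsCandidates D p) (L : PortLabelling) :
    C.Accepts p ↔ D.R2 p ∧ D.R3 L p ∧ D.R4 p := by
  rw [← and_assoc, ← isArc_outgoing_iff, h.r4_iff]
  simp only [h.outgoing_self_iff, Accepts]

end ClaimsCandidates

theorem claims_exec_self : (C.exec L p).Claims p v ↔ C.Candidate p v ∧ C.Accepts p := by
  have h := claimsCandidates_line1_resolve C p
  rw [exec, h.noConflictAt.claims_line2_self, h.1, h.accepts_iff L]

theorem claims_exec_of_ne (h : u ≠ p) : (C.exec L p).Claims u v ↔ C.Claims u v := by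
  rw [exec, claims_line2_of_ne h, (claimsCandidates_line1_resolve C p).2 u v h]

theorem outgoing_exec_of_ne (hu : u ≠ p) (hv : v ≠ p) :
    (C.exec L p).Outgoing u v ↔ C.Outgoing u v := by
  simp only [outgoing_iff, claims_exec_of_ne hu, claims_exec_of_ne hv]

theorem fire_singleton (L : PortLabelling) (C : Config) (p : Node) :
    C.fire L {p} = C.exec L p := by
  refine ext_claims (exec_support L C p).symm fun u v => ?_
  by_cases h : u = p
  · simp only [Claims, fire, h, mem_singleton, if_true]
  · rw [claims_exec_of_ne h]
    simp only [Claims, fire, h, mem_singleton, if_false]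

theorem exec_eq_self_iff : C.exec L p = C ↔ ∀ v, (C.exec L p).Claims p v ↔ C.Claims p v := by
  refine ⟨fun h v => by rw [h], fun h => ext_claims (exec_support L C p) fun u v => ?_⟩
  by_cases hu : u = p
  · rw [hu, h]
  · exact claims_exec_of_ne hu

theorem activable_iff : C.Activable L p ↔ p ∈ C.support ∧ C.exec L p ≠ C := by
  rw [Activable, Ne, Ne, exec_eq_self_iff, funext_iff]
  simp only [link_eq_link_iff]

/-! ### Clean configurations -/

/-- No edge of `p` is conflicting, and `p` satisfies R2, R3 and R4. -/
structure CleanAt (C : Config) (p : Node) : Prop where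
  noConflictAt : C.NoConflictAt p
  isArc : IsArc (directions p {q | C.Claims p q})
  r4 : C.R4 p

/-- Every particle is clean: apart from undirected edges, the configuration is valid. -/
def Clean (C : Config) : Prop :=
  ∀ p ∈ C.support, C.CleanAt p

theorem R4.rotate (h : C.R4 q) : ¬ (C.Outgoing p q ∧ C.Outgoing q r ∧ C.Outgoing r p) :=
  fun ⟨hpq, hqr, hrp⟩ => h r p ⟨hqr, hrp, hpq⟩

theorem noConflictAt_exec_self : (C.exec L p).NoConflictAt p := fun q hq => by
  rw [claims_exec_of_ne hq.adj.ne']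
  exact (claims_exec_self.1 hq).1.2.2.2

theorem cleanAt_exec_self : (C.exec L p).CleanAt p where
  noConflictAt := noConflictAt_exec_self
  isArc := by
    simp only [claims_exec_self]
    by_cases h : C.Accepts p
    · simpa only [h, and_true] using h.1
    · refine Or.inl (eq_empty_iff_forall_notMem.2 fun i hi => h (mem_directions.1 hi).2)
  r4 q r := by
    rintro ⟨hpq, hqr, hrp⟩
    have ⟨hcand, hacc⟩ := claims_exec_self.1 (outgoing_iff.1 hpq).1
    refine hacc.2 q r ⟨hcand, (outgoing_exec_of_ne hpq.adj.ne' hrp.adj.ne).1 hqr, ?_⟩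
    exact (claims_exec_of_ne hrp.adj.ne).1 (outgoing_iff.1 hrp).1

theorem CleanAt.exec (h : C.CleanAt p) (q : Node) : (C.exec L q).CleanAt p := by
  by_cases hpq : p = q
  · exact hpq ▸ cleanAt_exec_self
  refine ⟨fun v hv => ?_, ?_, fun a b hab => ?_⟩
  · by_cases hvq : v = q
    · subst hvq
      exact fun hvp => noConflictAt_exec_self p hvp hv
    · rw [claims_exec_of_ne hpq] at hv
      rw [claims_exec_of_ne hvq]
      exact h.noConflictAt v hv
  · simpa only [claims_exec_of_ne hpq] using h.isArc
  · have hq : (C.exec L q).R4 q := cleanAt_exec_self.r4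
    by_cases ha : a = q
    · subst ha
      exact hq.rotate hab
    by_cases hb : b = q
    · subst hb
      exact hq.rotate ⟨hab.2.1, hab.2.2, hab.1⟩
    rw [outgoing_exec_of_ne hpq ha, outgoing_exec_of_ne ha hb, outgoing_exec_of_ne hb hpq] at hab
    exact h.r4 a b hab

namespace Clean

theorem exec (h : C.Clean) (q : Node) : (C.exec L q).Clean := fun p hp =>
  (h p (by rwa [exec_support] at hp)).exec q

theorem asymm (h : C.Clean) (hpq : C.Claims p q) : ¬ C.Claims q p :=
  (h p hpq.left_mem).noConflictAt q hpq

theorem outgoing_iff_claims (h : C.Clean) : C.Outgoing p q ↔ C.Claims p q := by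
  rw [outgoing_iff, and_iff_left_of_imp h.asymm]

theorem no_triangle (h : C.Clean) : ¬ (C.Claims p q ∧ C.Claims q r ∧ C.Claims r p) := by
  rintro ⟨hpq, hqr, hrp⟩
  refine (h p hpq.left_mem).r4 q r ?_
  simp only [h.outgoing_iff_claims]
  exact ⟨hpq, hqr, hrp⟩

theorem candidate (h : C.Clean) (hpq : C.Claims p q) : C.Candidate p q :=
  (h p hpq.left_mem).noConflictAt.candidate_iff.2 (.inl hpq)

theorem exec_eq_self (h : C.Clean) (hp : p ∈ C.support) (hundir : ∀ q, ¬ C.Undirected p q) :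
    C.exec L p = C := by
  have hcand (q : Node) : C.Candidate p q ↔ C.Claims p q := by
    rw [(h p hp).noConflictAt.candidate_iff, or_iff_left (hundir q)]
  have hacc : C.Accepts p := by
    simp only [Accepts, hcand, h.outgoing_iff_claims]
    exact ⟨(h p hp).isArc, fun q r => h.no_triangle⟩
  refine exec_eq_self_iff.2 fun v => ?_
  rw [claims_exec_self, hcand, and_iff_left hacc]

end Clean

/-! ### Reachable configurations -/

/-- `D` is obtained from `C` by a sequence of executions of single particles. -/
abbrev Reach (L : PortLabelling) (C D : Config) : Prop :=
  Relation.ReflTransGen (SeqSuccessor L) C D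

theorem reach_exec (hp : p ∈ C.support) : Reach L C (C.exec L p) := by
  by_cases h : C.exec L p = C
  · rw [h]
  · exact .single ⟨p, activable_iff.2 ⟨hp, h⟩, (fire_singleton L C p).symm⟩

namespace Reach

theorem induction {I : Config → Prop} (h : Reach L C D) (base : I C)
    (step : ∀ E, Reach L C E → I E → ∀ p ∈ E.support, I (E.exec L p)) : I D := by
  induction h with
  | refl => exact base
  | tail hE hsucc ih =>
    obtain ⟨p, hp, rfl⟩ := hsucc
    rw [fire_singleton]
    exact step _ hE ih p hp.1

theorem support_eq (h : Reach L C D) : D.support = C.support :=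
  h.induction (I := fun D => D.support = C.support) rfl fun E _ hE p _ => by
    rw [exec_support, hE]

end Reach

theorem Clean.reach (hC : C.Clean) (h : Reach L C D) : D.Clean :=
  h.induction (I := Clean) hC fun _ _ hE p _ => hE.exec p

theorem exists_reach_clean (L : PortLabelling) (C : Config) : ∃ D, Reach L C D ∧ D.Clean := by
  suffices h : ∀ F ⊆ C.support, ∃ D, Reach L C D ∧ ∀ p ∈ F, D.CleanAt p by
    obtain ⟨D, hD, hclean⟩ := h _ Subset.rfl
    exact ⟨D, hD, fun p hp => hclean p (hD.support_eq ▸ hp)⟩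
  intro F
  induction F using Finset.induction_on with
  | empty => exact fun _ => ⟨C, .refl, by simp⟩
  | insert p F _ ih =>
    intro hF
    obtain ⟨D, hD, hclean⟩ := ih ((subset_insert _ _).trans hF)
    have hp : p ∈ D.support := hD.support_eq ▸ hF (mem_insert_self _ _)
    refine ⟨D.exec L p, hD.trans (reach_exec hp), fun q hq => ?_⟩
    obtain rfl | hq := mem_insert.1 hq
    · exact cleanAt_exec_self
    · exact (hclean q hq).exec p

/-! ### Closed sets of particles -/

/-- `X` contains all particles that have an undirected edge, and no edge leaves `X`. In a clean
configuration only particles of `X` can then become active, now or later. -/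
structure Closed (C : Config) (X : Finset Node) : Prop where
  subset : X ⊆ C.support
  undirected : ∀ p q, C.Undirected p q → p ∈ X
  claims : ∀ p ∈ X, ∀ q, C.Claims p q → q ∈ X

theorem closed_support (C : Config) : C.Closed C.support where
  subset := Subset.rfl
  undirected _ _ h := h.1
  claims _ _ _ h := h.right_mem

namespace Closed

theorem claims_of_notMem (h : C.Closed X) (hp : p ∈ C.support) (hpX : p ∉ X) (hq : q ∈ X)
    (hpq : triGrid.Adj p q) : C.Claims p q := by
  by_contra hnot
  refine hpX (h.undirected p q (undirected_iff.2 ⟨hp, h.subset hq, hpq, hnot, fun hqp => ?_⟩))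
  exact hpX (h.claims q hq p hqp)

theorem mem_of_candidate (h : C.Closed X) (hp : p ∈ X) (hpq : C.Candidate p q) : q ∈ X := by
  by_contra hq
  exact hpq.2.2.2 (h.claims_of_notMem hpq.2.1 hq hp hpq.2.2.1.symm)

theorem exec_of_mem (h : C.Closed X) (hp : p ∈ X) : (C.exec L p).Closed X where
  subset := by
    rw [exec_support]
    exact h.subset
  undirected u v huv := by
    by_cases hup : u = p
    · exact hup ▸ hp
    simp only [undirected_iff, exec_support, claims_exec_of_ne hup] at huv
    obtain ⟨hu, hv, hadj, hclaim, hclaim'⟩ := huv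
    by_cases hvp : v = p
    · subst hvp
      exact h.mem_of_candidate hp ⟨hv, hu, hadj.symm, hclaim⟩
    · rw [claims_exec_of_ne hvp] at hclaim'
      exact h.undirected u v (undirected_iff.2 ⟨hu, hv, hadj, hclaim, hclaim'⟩)
  claims u hu v huv := by
    by_cases hup : u = p
    · subst hup
      exact h.mem_of_candidate hu (claims_exec_self.1 huv).1
    · exact h.claims u hu v ((claims_exec_of_ne hup).1 huv)

theorem exec (h : C.Closed X) (hC : C.Clean) (hp : p ∈ C.support) : (C.exec L p).Closed X := by
  by_cases hpX : p ∈ X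
  · exact h.exec_of_mem hpX
  · rwa [hC.exec_eq_self hp fun q hq => hpX (h.undirected p q hq)]

theorem reach (h : C.Closed X) (hC : C.Clean) (hD : Reach L C D) : D.Closed X :=
  hD.induction (I := fun D => D.Closed X) h fun _ hE hX _ hp => hX.exec (hC.reach hE) hp

theorem noHole (h : C.Closed X) (hC : C.Clean) (hP : NoHole triGrid C.support) :
    NoHole triGrid X := by
  intro Y hY
  by_cases hYP : Y ⊆ C.support
  · by_contra! hcon
    have hmem (w : Node) (hw : w ∈ Y \ X) : w ∈ C.support ∧ w ∉ X :=
      ⟨hYP (mem_sdiff.1 hw).1, (mem_sdiff.1 hw).2⟩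
    have hempty : Y \ X = ∅ := by
      refine eq_empty_of_outward (O := C.Claims) (fun w hw => (hC w (hmem w hw).1).isArc)
        (fun w hw v hwv hv => ?_) fun w hw v hv hwv => ?_
      · have hvY : v ∈ Y := by
          by_contra hvY
          exact hcon w (mem_sdiff.1 hw).1 (hmem w hw).2 v hvY hwv
        refine h.claims_of_notMem (hmem w hw).1 (hmem w hw).2 ?_ hwv
        by_contra hvX
        exact hv (mem_sdiff.2 ⟨hvY, hvX⟩)
      · by_contra! hnot
        exact (hmem w hw).2 (h.undirected w v
          (undirected_iff.2 ⟨(hmem w hw).1, (hmem v hv).1, hwv, hnot⟩))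
    exact hY.2 (sdiff_eq_empty_iff_subset.1 hempty)
  · obtain ⟨y, hy, hyP⟩ := not_subset.1 hYP
    obtain ⟨q, hq, hqP, z, hz, hqz⟩ := hP (C.support ∪ Y)
      ⟨subset_union_left, fun hsub => hyP (hsub (mem_union_right _ hy))⟩
    exact ⟨q, (mem_union.1 hq).resolve_left hqP, fun hqX => hqP (h.subset hqX), z,
      fun hzY => hz (mem_union_right _ hzY), hqz⟩

end Closed

/-! ### Particles that never become sinks -/

/-- `u` claims the edge `uv` in all configurations that can be reached from `C`. -/
def AlwaysClaims (L : PortLabelling) (C : Config) (u v : Node) : Prop :=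
  ∀ D, Reach L C D → D.Claims u v

/-- In all configurations that can be reached from `C`, `p` claims some edge, not always the same
one. -/
def NeverSink (L : PortLabelling) (C : Config) (p : Node) : Prop :=
  ∀ D, Reach L C D → ∃ v, D.Claims p v

/-- No further claim can become permanent. -/
def Stable (L : PortLabelling) (C : Config) : Prop :=
  ∀ D, Reach L C D → ∀ u v, D.AlwaysClaims L u v → C.AlwaysClaims L u v

theorem AlwaysClaims.reach (h : C.AlwaysClaims L u v) (hD : Reach L C D) :
    D.AlwaysClaims L u v := fun E hE => h E (hD.trans hE)

theorem NeverSink.reach (h : C.NeverSink L p) (hD : Reach L C D) : D.NeverSink L p :=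
  fun E hE => h E (hD.trans hE)

theorem Stable.reach (h : C.Stable L) (hD : Reach L C D) : D.Stable L := fun E hE u v hclaim =>
  (h E (hD.trans hE) u v hclaim).reach hD

theorem exists_reach_stable (L : PortLabelling) (C : Config) : ∃ D, Reach L C D ∧ D.Stable L := by
  classical
  let T (D : Config) : Finset (Node × Node) :=
    {e ∈ C.support ×ˢ C.support | ¬ D.AlwaysClaims L e.1 e.2}
  obtain ⟨D, hD, hmin⟩ := exists_minimalFor_of_wellFoundedLT (Reach L C) T ⟨C, .refl⟩
  refine ⟨D, hD, fun E hE u v hclaim => ?_⟩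
  have hTE : T E ⊆ T D := monotone_filter_right _ fun e _ he hD => he (hD.reach hE)
  have hTD : T D ⊆ T E := hmin (hD.trans hE) hTE
  have huv : E.Claims u v := hclaim E .refl
  have hmem : (u, v) ∈ C.support ×ˢ C.support := by
    rw [← hD.support_eq, ← hE.support_eq]
    exact mem_product.2 ⟨huv.left_mem, huv.right_mem⟩
  by_contra hnot
  exact (mem_filter.1 (hTD (mem_filter.2 ⟨hmem, hnot⟩))).2 hclaim

namespace NeverSink

/-- Whenever `p` executes, it either claims all its candidates, among which are the edges that it
claims already, or it becomes a sink. -/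
theorem alwaysClaims (h : C.NeverSink L p) (hC : C.Clean) (hpv : C.Claims p v) :
    C.AlwaysClaims L p v := fun D hD => by
  refine hD.induction (I := fun D => D.Claims p v) hpv fun E hE hpv r hr => ?_
  by_cases hrp : p = r
  · subst hrp
    obtain ⟨w, hw⟩ := h _ (hE.trans (reach_exec hr))
    exact claims_exec_self.2 ⟨(hC.reach hE).candidate hpv, (claims_exec_self.1 hw).2⟩
  · rwa [claims_exec_of_ne hrp]

theorem not_undirected (h : C.NeverSink L p) (hC : C.Clean) (hstable : C.Stable L) :
    ¬ C.Undirected p v := by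
  intro hundir
  have hexec : Reach L C (C.exec L p) := reach_exec hundir.1
  obtain ⟨w, hw⟩ := h _ hexec
  have hpv : (C.exec L p).Claims p v :=
    claims_exec_self.2 ⟨(hC p hundir.1).noConflictAt.candidate_iff.2 (.inr hundir),
      (claims_exec_self.1 hw).2⟩
  have := hstable _ hexec p v ((h.reach hexec).alwaysClaims (hC.exec p) hpv)
  exact (undirected_iff.1 hundir).2.2.2.1 (this C .refl)

theorem of_claims (h : C.NeverSink L q) (hC : C.Clean) (hstable : C.Stable L)
    (hpq : C.Claims p q) : C.NeverSink L p := by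
  intro E hE
  by_contra! hsink
  have hsupp := hE.support_eq
  have hqp : E.Claims q p := by
    by_contra hqp
    exact (h.reach hE).not_undirected (hC.reach hE) (hstable.reach hE) (undirected_iff.2
      ⟨hsupp ▸ hpq.right_mem, hsupp ▸ hpq.left_mem, hpq.adj.symm, hqp, hsink q⟩)
  have := hstable E hE q p ((h.reach hE).alwaysClaims (hC.reach hE) hqp)
  exact hC.asymm hpq (this C .refl)

end NeverSink

/-! ### Minimal closed sets -/

/-- `X` is closed, and none of its proper subsets ever becomes closed. -/
structure MinimalClosed (L : PortLabelling) (C : Config) (X : Finset Node) : Prop where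
  closed : C.Closed X
  eq_of_subset : ∀ D, Reach L C D → ∀ Z ⊆ X, D.Closed Z → Z = X

namespace MinimalClosed

theorem reach (h : C.MinimalClosed L X) (hC : C.Clean) (hD : Reach L C D) :
    D.MinimalClosed L X :=
  ⟨h.closed.reach hC hD, fun E hE => h.eq_of_subset E (hD.trans hE)⟩

theorem exists_reach_no_claims (h : C.MinimalClosed L X) (hC : C.Clean) (hq : q ∈ X) :
    ∃ D, Reach L C D ∧ ∀ v, ¬ D.Claims q v := by
  classical
  obtain ⟨D, hCD, hstable⟩ := exists_reach_stable L C
  have hD : D.Clean := hC.reach hCD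
  have hDX : D.Closed X := h.closed.reach hC hCD
  have hclosed : D.Closed {p ∈ X | ¬ D.NeverSink L p} := by
    refine ⟨(filter_subset _ _).trans hDX.subset, fun p v hpv => ?_, fun p hp v hpv => ?_⟩
    · exact mem_filter.2 ⟨hDX.undirected p v hpv, fun hp => hp.not_undirected hD hstable hpv⟩
    · obtain ⟨hpX, hp⟩ := mem_filter.1 hp
      exact mem_filter.2 ⟨hDX.claims p hpX v hpv, fun hv => hp (hv.of_claims hD hstable hpv)⟩
  rw [← h.eq_of_subset D hCD _ (filter_subset _ _) hclosed] at hq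
  have hsink := (mem_filter.1 hq).2
  unfold NeverSink at hsink
  push Not at hsink
  obtain ⟨E, hE, hno⟩ := hsink
  exact ⟨E, hCD.trans hE, hno⟩

end MinimalClosed

/-- All edges of `u` are directed, and the one to `b` is outgoing. -/
def Anchored (C : Config) (u b : Node) : Prop :=
  C.Claims u b ∧ ∀ v, ¬ C.Undirected u v

theorem Closed.accepts (hX : C.Closed X) (hu : u ∈ X) (hb : C.Candidate u b)
    (hcenter : ∀ v ∈ X, triGrid.Adj u v → v = b ∨ triGrid.Adj b v)
    (htri : ∀ q r, ¬ (C.Candidate u q ∧ C.Outgoing q r ∧ C.Claims r u)) : C.Accepts u :=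
  ⟨isArc_directions_iff.2 <| .inr ⟨b, hb, hb.2.2.1, fun v hv =>
    hcenter v (hX.mem_of_candidate hu hv)⟩, htri⟩

theorem anchored_exec_self (hb : C.Candidate u b) (hacc : C.Accepts u) :
    (C.exec L u).Anchored u b := by
  refine ⟨claims_exec_self.2 ⟨hb, hacc⟩, fun v hv => ?_⟩
  rw [undirected_iff, exec_support] at hv
  obtain ⟨hu, hv, huv, hclaim, hclaim'⟩ := hv
  rw [claims_exec_of_ne huv.ne'] at hclaim'
  exact hclaim (claims_exec_self.2 ⟨⟨hu, hv, huv, hclaim'⟩, hacc⟩)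

namespace Anchored

theorem claims_of_exec (h : C.Anchored u b) (hru : (C.exec L p).Claims r u) : C.Claims r u := by
  by_cases hrp : r = p
  · subst hrp
    exact (claims_exec_self.1 hru).1.claims_or_undirected.resolve_right fun hund =>
      h.2 r hund.symm
  · exact (claims_exec_of_ne hrp).1 hru

theorem exec (h : C.Anchored u b) (hC : C.Clean)
    (hpu : (C.exec L p).Claims p u ↔ C.Claims p u) : (C.exec L p).Anchored u b := by
  by_cases hup : u = p
  · subst hup
    rwa [hC.exec_eq_self h.1.left_mem h.2]
  · refine ⟨(claims_exec_of_ne hup).2 h.1, fun v hv => h.2 v ?_⟩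
    rw [undirected_iff, exec_support, claims_exec_of_ne hup] at hv
    rw [undirected_iff]
    by_cases hvp : v = p
    · subst hvp
      rwa [hpu] at hv
    · rwa [claims_exec_of_ne hvp] at hv

/-- When `p` drops the edge `pu`, it drops all its edges, so that `u` can claim `pu` without
closing a directed triangle. -/
theorem exec_exec (h : C.Anchored u b) (hC : C.Clean) (hX : C.Closed X) (hu : u ∈ X)
    (hcenter : ∀ v ∈ X, triGrid.Adj u v → v = b ∨ triGrid.Adj b v)
    (hpu : C.Claims p u) (hdrop : ¬ (C.exec L p).Claims p u) :
    ((C.exec L p).exec L u).Anchored u b := by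
  have hreject : ¬ C.Accepts p := fun hacc => hdrop (claims_exec_self.2 ⟨hC.candidate hpu, hacc⟩)
  have hno (v : Node) : ¬ (C.exec L p).Claims p v := fun hv => hreject (claims_exec_self.1 hv).2
  have hclean : (C.exec L p).Clean := hC.exec p
  have hub : (C.exec L p).Claims u b := (claims_exec_of_ne hpu.adj.ne').2 h.1
  refine anchored_exec_self (hclean.candidate hub) ?_
  refine (hX.exec hC hpu.left_mem).accepts hu (hclean.candidate hub) hcenter ?_
  rintro q r ⟨huq, hqr, hru⟩
  have hqp : q ≠ p := by
    rintro rfl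
    exact hno r (outgoing_iff.1 hqr).1
  have huq : (C.exec L p).Claims u q := by
    refine huq.claims_or_undirected.resolve_right fun hund => h.2 q ?_
    rw [undirected_iff, exec_support, claims_exec_of_ne hpu.adj.ne', claims_exec_of_ne hqp] at hund
    exact undirected_iff.2 hund
  exact hclean.no_triangle ⟨huq, (outgoing_iff.1 hqr).1, hru⟩

end Anchored

theorem exists_reach_incoming_eq (hanch : C.Anchored u b) (hC : C.Clean) (hX : C.Closed X)
    (hu : u ∈ X) (hcenter : ∀ v ∈ X, triGrid.Adj u v → v = b ∨ triGrid.Adj b v)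
    (L : PortLabelling) :
    ∃ D, Reach L C D ∧ D.Anchored u b ∧
      ∀ E, Reach L D E → ∀ r, E.Claims r u ↔ D.Claims r u := by
  classical
  let incoming (D : Config) : Finset Node := {r ∈ C.support | D.Claims r u}
  have mem_incoming {D : Config} (hD : Reach L C D) (r : Node) :
      r ∈ incoming D ↔ D.Claims r u := by
    simp only [incoming, mem_filter, ← hD.support_eq, and_iff_right_of_imp Claims.left_mem]
  obtain ⟨D, ⟨hCD, hD⟩, hmin⟩ := exists_minimalFor_of_wellFoundedLT
    (fun D => Reach L C D ∧ D.Anchored u b) incoming ⟨C, .refl, hanch⟩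
  refine ⟨D, hCD, hD, fun E hE => And.right (a := E.Anchored u b) ?_⟩
  refine hE.induction (I := fun E => E.Anchored u b ∧ ∀ r, E.Claims r u ↔ D.Claims r u)
    ⟨hD, fun r => Iff.rfl⟩ fun G hG hGD p hp => ?_
  obtain ⟨hanch, hin⟩ := hGD
  have hCG : Reach L C G := hCD.trans hG
  have hclean : G.Clean := hC.reach hCG
  have hsame : (G.exec L p).Claims p u ↔ G.Claims p u := by
    refine ⟨hanch.claims_of_exec, fun hpu => ?_⟩
    by_contra hdrop
    have hnext := hanch.exec_exec hclean (hX.reach hC hCG) hu hcenter hpu hdrop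
    have hCH : Reach L C ((G.exec L p).exec L u) := (hCG.trans (reach_exec hp)).trans
      (reach_exec (by rw [exec_support]; exact hpu.right_mem))
    have hmono (r : Node) (hr : ((G.exec L p).exec L u).Claims r u) : (G.exec L p).Claims r u :=
      (claims_exec_of_ne hr.adj.ne).1 hr
    have hsub : incoming ((G.exec L p).exec L u) ⊆ incoming D := fun r hr => by
      rw [mem_incoming hCH] at hr
      rw [mem_incoming hCD, ← hin]
      exact hanch.claims_of_exec (hmono r hr)
    have hp := hmin ⟨hCH, hnext⟩ hsub ((mem_incoming hCD p).2 ((hin p).1 hpu))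
    exact hdrop (hmono p ((mem_incoming hCH p).1 hp))
  refine ⟨hanch.exec hclean hsame, fun r => (Iff.trans ?_ (hin r))⟩
  by_cases hrp : r = p
  · exact hrp ▸ hsame
  · exact claims_exec_of_ne hrp

theorem Closed.erase (hX : C.Closed X) (hundir : ∀ v, ¬ C.Undirected u v)
    (hin : ∀ r ∈ X, ¬ C.Claims r u) : C.Closed (X.erase u) where
  subset := (erase_subset _ _).trans hX.subset
  undirected p q hpq := mem_erase.2
    ⟨fun hpu => hundir q (hpu ▸ hpq), hX.undirected p q hpq⟩
  claims p hp q hpq := mem_erase.2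
    ⟨fun hqu => hin p (mem_of_mem_erase hp) (hqu ▸ hpq), hX.claims p (mem_of_mem_erase hp) q hpq⟩

namespace MinimalClosed

theorem exists_claims (h : C.MinimalClosed L X) (hu : u ∈ X)
    (hundir : ∀ v, ¬ C.Undirected u v) : ∃ r ∈ X, C.Claims r u := by
  by_contra! hin
  have herase := h.eq_of_subset C .refl _ (erase_subset u X) (h.closed.erase hundir hin)
  exact notMem_erase u X (by rwa [herase])

theorem not_anchored (h : C.MinimalClosed L X) (hC : C.Clean) (hu : u ∈ X)
    (hcenter : ∀ v ∈ X, triGrid.Adj u v → v = b ∨ triGrid.Adj b v) : ¬ C.Anchored u b := by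
  intro hanch
  obtain ⟨D, hD, hDu, hin⟩ := exists_reach_incoming_eq hanch hC h.closed hu hcenter L
  have hmin := h.reach hC hD
  obtain ⟨r, hr, hru⟩ := hmin.exists_claims hu hDu.2
  obtain ⟨E, hE, hno⟩ := hmin.exists_reach_no_claims (hC.reach hD) hr
  exact hno u ((hin E hE r).2 hru)

theorem exists_reach_anchored (h : C.MinimalClosed L X) (hC : C.Clean) (hu : u ∈ X) (hb : b ∈ X)
    (hub : triGrid.Adj u b) (hcenter : ∀ v ∈ X, triGrid.Adj u v → v = b ∨ triGrid.Adj b v) :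
    ∃ D, Reach L C D ∧ D.Anchored u b := by
  obtain ⟨D, hD, hno⟩ := h.exists_reach_no_claims hC hb
  have hX : D.Closed X := h.closed.reach hC hD
  have hcand : D.Candidate u b := ⟨hX.subset hu, hX.subset hb, hub, hno u⟩
  refine ⟨D.exec L u, hD.trans (reach_exec (hX.subset hu)), anchored_exec_self hcand ?_⟩
  refine hX.accepts hu hcand hcenter ?_
  rintro q r ⟨huq, hqr, hru⟩
  have hqX : q ∈ X := hX.mem_of_candidate hu huq
  have hbq : triGrid.Adj b q := (hcenter q hqX huq.2.2.1).resolve_left <| by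
    rintro rfl
    exact hno r (outgoing_iff.1 hqr).1
  have hrX : r ∈ X := hX.claims q hqX r (outgoing_iff.1 hqr).1
  have hbr : triGrid.Adj b r := (hcenter r hrX hru.adj.symm).resolve_left <| by
    rintro rfl
    exact hno u hru
  exact not_adj_of_adj_of_adj hub.symm hbq hbr huq.2.2.1 hqr.adj hru.adj.symm

theorem eq_empty (h : C.MinimalClosed L X) (hC : C.Clean) (hP : NoHole triGrid C.support) :
    X = ∅ := by
  by_contra! hne
  obtain ⟨u, hu, harc⟩ := (h.closed.noHole hC hP).exists_isArc hne
  obtain hisolated | ⟨b, hb, hub, hcenter⟩ := isArc_directions_iff.1 harc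
  · obtain ⟨r, hr, hru⟩ := h.exists_claims hu fun v huv =>
      hisolated v (h.closed.undirected v u huv.symm) huv.2.2.1
    exact hisolated r hr hru.adj.symm
  · obtain ⟨D, hD, hanch⟩ := h.exists_reach_anchored hC hu hb hub hcenter
    exact (h.reach hC hD).not_anchored (hC.reach hD) hu hcenter hanch

end MinimalClosed

theorem exists_reach_directed (hC : C.Clean) (hP : NoHole triGrid C.support) (L : PortLabelling) :
    ∃ D, Reach L C D ∧ D.Clean ∧ ∀ p q, ¬ D.Undirected p q := by
  obtain ⟨X, ⟨D, hD, hX⟩, hmin⟩ := exists_minimal_of_wellFoundedLT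
    (fun X => ∃ D, Reach L C D ∧ D.Closed X) ⟨C.support, C, .refl, closed_support C⟩
  have hDmin : D.MinimalClosed L X :=
    ⟨hX, fun E hE Z hZ hEZ => hZ.antisymm (hmin ⟨E, hD.trans hE, hEZ⟩ hZ)⟩
  have hempty : X = ∅ := hDmin.eq_empty (hC.reach hD) (hD.support_eq ▸ hP)
  exact ⟨D, hD, hC.reach hD, fun p q hpq => notMem_empty p (hempty ▸ hX.undirected p q hpq)⟩

/-! ### Configurations in which all edges are directed -/

theorem claims_or_claims (hdirected : ∀ p q, ¬ C.Undirected p q) (hp : p ∈ C.support)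
    (hq : q ∈ C.support) (hpq : triGrid.Adj p q) : C.Claims p q ∨ C.Claims q p := by
  by_contra! hnot
  exact hdirected p q (undirected_iff.2 ⟨hp, hq, hpq, hnot⟩)

namespace Clean

theorem final (hC : C.Clean) (hdirected : ∀ p q, ¬ C.Undirected p q) (L : PortLabelling) :
    C.Final L := fun p hp =>
  have ⟨hmem, hne⟩ := activable_iff.1 hp
  hne (hC.exec_eq_self hmem (hdirected p))

theorem valid (hC : C.Clean) (hdirected : ∀ p q, ¬ C.Undirected p q) (L : PortLabelling) :
    C.Valid L := by
  intro p hp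
  have harc : C.R2 p ∧ C.R3 L p := by
    simp only [← isArc_outgoing_iff, hC.outgoing_iff_claims]
    exact (hC p hp).isArc
  refine ⟨fun q hq hpq => ?_, harc.1, harc.2, (hC p hp).r4⟩
  simp only [hC.outgoing_iff_claims]
  exact claims_or_claims hdirected hp hq hpq

theorem existsUnique_isSink (hC : C.Clean) (hdirected : ∀ p q, ¬ C.Undirected p q)
    (hne : C.support.Nonempty) (hhole : NoHole triGrid C.support)
    (hcut : NoCut triGrid C.support) : ∃! p, C.IsSink p := by
  simp only [IsSink, hC.outgoing_iff_claims]
  exact existsUnique_sink_of_orientation hhole hcut hne (fun _ _ => Claims.adj)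
    (fun _ _ => hC.asymm) (fun _ hp _ hq => claims_or_claims hdirected hp hq)
    (fun _ _ _ => hC.no_triangle) (fun _ _ => Claims.right_mem) fun p hp => (hC p hp).isArc

end Clean

end Config

/-! ### Simply connected sets -/

theorem mem_of_reachable_induce {s : Set Node} {A : Finset Node}
    (hA : ∀ u ∈ A, u ∈ s → ∀ v ∈ s, triGrid.Adj u v → v ∈ A) {a b : s}
    (h : (triGrid.induce s).Reachable a b) (ha : (a : Node) ∈ A) : (b : Node) ∈ A := by
  obtain ⟨w⟩ := h
  induction w with
  | nil => exact ha
  | @cons u v _ hadj _ ih => exact ih (hA u ha u.2 v v.2 hadj)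

namespace SimplyConnected

variable {P : Finset Node}

theorem nonempty (h : SimplyConnected P) : P.Nonempty :=
  have ⟨p⟩ := h.connected.nonempty
  ⟨p, p.2⟩

theorem noHole (h : SimplyConnected P) : NoHole triGrid P := by
  intro Y hY
  by_contra! hcon
  obtain ⟨y, hy, hyP⟩ := exists_of_ssubset hY
  obtain ⟨z, hz⟩ := Infinite.exists_notMem_finset Y
  refine hz (mem_of_reachable_induce (fun u hu huP v _ huv => ?_)
    (h.compl_connected.preconnected ⟨y, hyP⟩ ⟨z, fun hzP => hz (hY.1 hzP)⟩) hy)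
  by_contra hv
  exact hcon u hu huP v hv huv

theorem noCut (h : SimplyConnected P) : NoCut triGrid P := by
  rintro A ⟨hAP, hA⟩ ⟨a, ha⟩
  refine hAP.antisymm fun b hb => ?_
  exact mem_of_reachable_induce (fun u hu _ v hv huv => hA u hu v hv huv)
    (h.connected.preconnected ⟨a, hAP ha⟩ ⟨b, hb⟩) ha

end SimplyConnected

/-! ### Fair executions -/

theorem finite_setOf_support_eq (P : Finset Node) : {C : Config | C.support = P}.Finite := by
  refine Set.Finite.of_injOn (f := fun C : Config => {e : Node × Node | C.Claims e.1 e.2})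
    (t := {E | E ⊆ ↑(P ×ˢ P)}) ?_ ?_ (P ×ˢ P).finite_toSet.finite_subsets
  · rintro C rfl e he
    exact mem_coe.2 (mem_product.2 ⟨Config.Claims.left_mem he, Config.Claims.right_mem he⟩)
  · intro C hC D hD hCD
    exact Config.ext_claims (Eq.trans hC (Eq.symm hD)) fun u v => Set.ext_iff.1 hCD (u, v)

variable {L : PortLabelling} {S : ℕ → Config}

theorem exists_infinitelyOften (h : ∀ i, (S i).support = (S 0).support) :
    ∃ C, InfinitelyOften S C := by
  have := (finite_setOf_support_eq (S 0).support).to_subtype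
  obtain ⟨C, hC⟩ := Finite.exists_infinite_fiber
    (fun i => (⟨S i, h i⟩ : {C : Config | C.support = (S 0).support}))
  refine ⟨C, fun n => ?_⟩
  obtain ⟨i, hi, hn⟩ := (Set.infinite_coe_iff.1 hC).exists_gt n
  exact ⟨i, hn.le, congrArg Subtype.val hi⟩

theorem InfinitelyOften.reach
    (hfair : ∀ C C', InfinitelyOften S C → C.SeqSuccessor L C' → InfinitelyOften S C')
    {C D : Config} (hC : InfinitelyOften S C) (hD : Config.Reach L C D) : InfinitelyOften S D := by
  induction hD with
  | refl => exact hC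
  | tail _ hsucc ih => exact hfair _ _ ih hsucc

theorem Config.SeqSuccessor.successor {C C' : Config} (h : C.SeqSuccessor L C') :
    C.Successor L C' := by
  obtain ⟨p, hp, rfl⟩ := h
  exact ⟨{p}, singleton_nonempty p, fun q hq => by rwa [mem_singleton.1 hq], rfl⟩

theorem IsSeqExecution.isExecution (h : IsSeqExecution L S) : IsExecution L S :=
  fun i => (h i).imp_left Config.SeqSuccessor.successor

theorem IsExecution.support_eq (h : IsExecution L S) (i : ℕ) :
    (S i).support = (S 0).support := by
  induction i with
  | zero => rfl
  | succ i ih =>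
    obtain ⟨Q, -, -, hstep⟩ | ⟨-, hstep⟩ := h i
    · rw [hstep]
      exact ih
    · rw [hstep, ih]

end ParticleSystem

open ParticleSystem in
theorem theorem2_general (L : PortLabelling) (S : ℕ → Config)
    (hP : SimplyConnected (S 0).support) (hS : IsExecution L S)
    (hfair : ∀ C C', InfinitelyOften S C → C.SeqSuccessor L C' → InfinitelyOften S C') :
    ∃ n, (S n).Final L ∧ (S n).Valid L ∧ ∃! p, (S n).IsSink p := by
  obtain ⟨C, hC⟩ := exists_infinitelyOften hS.support_eq
  obtain ⟨i, -, rfl⟩ := hC 0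
  obtain ⟨D, hD, hDclean⟩ := Config.exists_reach_clean L (S i)
  have hDsupp : D.support = (S 0).support := hD.support_eq.trans (hS.support_eq i)
  obtain ⟨E, hE, hEclean, hdirected⟩ :=
    Config.exists_reach_directed hDclean (hDsupp ▸ hP.noHole) L
  obtain ⟨n, -, rfl⟩ := hC.reach hfair (hD.trans hE) 0
  rw [← hS.support_eq n] at hP
  exact ⟨n, hEclean.final hdirected L, hEclean.valid hdirected L,
    hEclean.existsUnique_isSink hdirected hP.nonempty hP.noHole hP.noCut⟩

theorem theorem2 (L : ParticleSystem.PortLabelling) (S : ℕ → ParticleSystem.Config)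
    (hP : ParticleSystem.SimplyConnected (S 0).support)
    (hS : ParticleSystem.IsGoudaFairExecution L S ∨ ParticleSystem.IsSeqGoudaFairExecution L S) :
    ∃ n, (S n).Final L ∧ (S n).Valid L ∧ ∃! p, (S n).IsSink p :=
  hS.elim
    (fun h => theorem2_general L S hP h.1 fun C C' hC hCC' => h.2 C C' hC hCC'.successor)
    fun h => theorem2_general L S hP h.1.isExecution h.2
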